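/- **Conventions.** Fix $\eta\in\mathbb C\setminus\{0\}$ and put $q=e^{\eta}$, $q^{r}=e^{r\eta}$. Let $I\subset\mathbb Z_{>0}$, $J\subset\mathbb Z_{<0}$ be finite, $t=(t_i)_{i\in I\cup J}$ with $t_i\in\mathbb C^\times$; functions of $t$ may be multivalued, i.e. they are functions of $\theta=(\log t_i)$ on the universal cover of the torus, and $c^{d}=e^{d\log c}$. Let $T_i$ be the shift $t_i\mapsto qt_i$ ($i\in I$), $t_i\mapsto q^{-1}t_i$ ($i\in J$), and $T_{ij}=T_iT_j$. The lattice $q$-UC hierarchy for $\sigma_{m,n}(t)$ $(m,n\in\mathbb Z)$ is $$t_iT_i(\sigma_{m,n+1})T_j(\sigma_{m+1,n})-t_jT_j(\sigma_{m,n+1})T_i(\sigma_{m+1,n})=(t_i-t_j)T_{ij}(\sigma_{m,n})\sigma_{m+1,n+1}\qquad(i,j\in I\cup J).$$ A *similarity solution with periodic condition of order $(N_1,N_2)$ and exponents $d_{m,n}\in\mathbb C$* is a solution with $\sigma_{m+N_1,n}=\sigma_{m,n+N_2}=\sigma_{m,n}$ and $\sigma_{m,n}(ct)=c^{d_{m,n}}\sigma_{m,n}(t)$,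 where $d_{m,n}+d_{m+1,n+1}=d_{m+1,n}+d_{m,n+1}$. Below it is assumed that no $\sigma_{m,n}$ vanishes on the $q$-lattice through the point considered, and that the independent variables are generic in the sense stated. **Theorem.** The $q$-Painlevé equations of types $A^{(1)}_{2g+1}$ $(g\ge1)$, $D^{(1)}_5$, $E^{(1)}_6$ are similarity reductions of the lattice $q$-UC hierarchy with periodic conditions of order $(g+1,g+1)$, $(2,2)$, $(3,3)$, respectively. Precisely: **(A)** Let $I=\{1,2\}$, $J=\{-1,-2\}$, $g\ge 1$, $N=2g+2$, and let $\sigma$ be a similarity solution of order $(g+1,g+1)$. For $\alpha,x\in\mathbb C^\times$ (with chosen logarithms) and $n\in\mathbb Z$ put $\alpha_n=q^{n/2}\alpha$; let $\tau_{2j}(n)$ be the value of $\sigma_{-j,j}$ and $\tau_{2j+1}(n)$ that of $\sigma_{-j,j+1}$ at $t_1=\alpha_n$, $t_2=\alpha_n^{-1}$ and $(t_{-1},t_{-2})=(-q^{-1}x,-q^{-1\mp1/2}x)$ for even $n$, $(t_{-1},t_{-2})=(-q^{-1\mp1/2}x,-q^{-1}x)$ for odd $n$, with upper sign for $\tau_{2j}$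 and lower sign for $\tau_{2j+1}$. Assume $\alpha_n^{2(g+1)}\ne1$ and $\alpha_n^{\pm1}\neq -x$ for all $n$. Then $$f_i(n)=q^{-1/4}\alpha_n\frac{\tau_{i+2}(n)\,\tau_i(n-1)}{\tau_{i+2}(n-1)\,\tau_i(n)}\qquad(i\in\mathbb Z/N\mathbb Z)$$ is a (nowhere zero) solution of the $q$-Painlevé equation of type $A^{(1)}_{2g+1}$ $$f_i(n+1)=a_ia_{i+1}f_{i+1}(n)\frac{Q_{i+2}(n)}{Q_i(n)},\qquad Q_i=\sum_{k=0}^{N-1}\prod_{l=0}^{k-1}a_{i+l}f_{i+l},\qquad \prod_{j=0}^{g}f_{2j}=\prod_{j=0}^{g}f_{2j+1},$$ with all $Q_i(n)\neq0$ and parameters $a_{2j}=q^{1/4}x^{-1}q^{(d_{-j-1,j+1}-d_{-j,j})/2}$, $a_{2j+1}=q^{1/4}x\,q^{(d_{-j,j+1}-d_{-j-1,j+2})/2}$, for which $\prod_{i=0}^{N-1} a_i=q^{(g+1)/2}$. Every $a\in(\mathbb C^\times)^{\mathbb Z/N\mathbb Z}$ with this product is of this form for some $x$ and some balanced exponents $d$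 that are $(g+1,g+1)$-periodic. **(D)** Let $I=\{1,2\}$, $J=\{-1,-2\}$, let $\sigma$ be a similarity solution of order $(2,2)$, and let $\rho_{m,n}(\alpha,\beta;x)$ be the value of $\sigma_{m,n}$ at $(t_1,t_2,t_{-1},t_{-2})=(\alpha,\alpha^{-1},-q^{-1}\beta x,-q^{-1}\beta^{-1}x)$. Put $\Phi^{(-)}_i(x)=\rho_{i,i}(\alpha,\beta;x)$, $\Phi^{(+)}_i(x)=\rho_{i,i}(q^{1/2}\alpha,q^{1/2}\beta;x)$, $\Psi^{(-)}_i(x)=\rho_{i,i+1}(\alpha,q^{1/2}\beta;q^{1/2}x)$, $\Psi^{(+)}_i(x)=\rho_{i,i+1}(q^{1/2}\alpha,\beta;q^{1/2}x)$, and $$f=\frac{\Phi_1^{(+)}\Phi_2^{(-)}}{\Phi_1^{(-)}\Phi_2^{(+)}},\quad g=\frac{\Psi_1^{(+)}\Psi_2^{(-)}}{\Psi_1^{(-)}\Psi_2^{(+)}},\quad \gamma=q^{(d_{1,1}-d_{1,2})/2},\quad\delta=q^{(d_{2,1}-d_{1,1})/2}.$$ If $t_i\ne q^kt_j$ for $i\in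 I$, $j\in J$, $k\in\mathbb Z$, then (with nonzero denominators) $$f(qx)f(x)=\frac{(g+\alpha^{-1}\beta^{-1}\gamma\delta x)(g+\alpha\beta\gamma^{-1}\delta^{-1}qx)}{(xg+\alpha\beta\gamma\delta)(qxg+\alpha^{-1}\beta^{-1}\gamma^{-1}\delta^{-1})},\quad g(q^{-1}x)g(x)=\frac{(f+\alpha^{-1}\beta\gamma^{-1}\delta x)(f+\alpha\beta^{-1}\gamma\delta^{-1}x)}{(xf+\alpha\beta^{-1}\gamma^{-1}\delta)(xf+\alpha^{-1}\beta\gamma\delta^{-1})}.$$ Equivalently, $y=xf(x)$, $z=q^{-1}x\,g(q^{-1}x)$, $t=x^2$, $\bar t=q^2t$ solve the $q$-Painlevé VI equation of Jimbo–Sakai $$\frac{y\bar y}{a_3a_4}=\frac{(\bar z-tb_1)(\bar z-tb_2)}{(\bar z-b_3)(\bar z-b_4)},\quad \frac{z\bar z}{b_3b_4}=\frac{(y-ta_1)(y-ta_2)}{(y-a_3)(y-a_4)},\quad \frac{b_1b_2}{b_3b_4}=q^2\frac{a_1a_2}{a_3a_4},$$ with $a=-(\alpha^{-1}\beta\gamma^{-1}\delta,\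 \alpha\beta^{-1}\gamma\delta^{-1},\ \alpha\beta^{-1}\gamma^{-1}\delta,\ \alpha^{-1}\beta\gamma\delta^{-1})$ and $b=-(\alpha^{-1}\beta^{-1}\gamma\delta,\ \alpha\beta\gamma^{-1}\delta^{-1}q,\ \alpha\beta\gamma\delta,\ (\alpha\beta\gamma\delta q)^{-1})$. Every $(a,b)\in(\mathbb C^\times)^8$ satisfying the last relation is obtained in this way, with balanced $(2,2)$-periodic $d$, up to a rescaling of $y,z,t$ by nonzero constants. **(E)** Let $a_0,\dots,a_6\in\mathbb C^\times$ (with chosen logarithms) satisfy $a_0a_1a_2^2a_3^3a_4^2a_5a_6^2=q$. Let $s_0,\dots,s_6$ act by $s_i(a_j)=a_ja_i^{-C_{ij}}$, where $C$ is the Cartan matrix of type $E_6^{(1)}$ with Dynkin edges $1\!-\!2,\ 2\!-\!3,\ 3\!-\!4,\ 4\!-\!5,\ 3\!-\!6,\ 6\!-\!0$, and by $s_i(f)=f$, $s_i(g)=g$ for $i\neq3$, $$s_3(f)=f\,\frac{c_xf+a_3^{-1}c_yg+a_3c_z}{a_3^{-1}c_xf+a_3c_yg+c_z},\qquad s_3(g)=g\,\frac{a_3c_xf+c_yg+a_3^{-1}c_z}{a_3^{-1}c_xf+a_3c_yg+c_z},$$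 $c_x=(a_1a_2^2a_4^{-2}a_5^{-1})^{1/3}$, $c_y=(a_5a_4^2a_6^{-2}a_0^{-1})^{1/3}$, $c_z=(a_0a_6^2a_2^{-2}a_1^{-1})^{1/3}$. Let $\ell=(s_2s_4s_6s_0s_1s_5s_3s_2s_4s_6s_3)^2$, where a word acts on rational functions by applying its letters successively from left to right. The $q$-Painlevé equation of type $E_6^{(1)}$ is $f(\bar a)=\ell(f)$, $g(\bar a)=\ell(g)$, the right sides being evaluated at $(a;f(a),g(a))$, where $\bar a=\ell(a)=(a_0,a_1,q^{-1}a_2,q^2a_3,q^{-1}a_4,a_5,q^{-1}a_6)$. Let $I=\{1,2,3\}$, $J=\emptyset$, and let $\sigma$ be a similarity solution of order $(3,3)$. Put $a=(a_0a_1a_5)^{1/3}$, $b=(a_2a_4a_6q)^{1/3}$, let $\tilde\sigma_{m,n}(a,b)$ be the value of $\sigma_{m,n}$ at $(t_1,t_2,t_3)=(a^{-1},b^{-1},ab)$, and $$U_i=\tilde\sigma_{i,-i}(a,b),\quad V_i=\tilde\sigma_{i+1,-i+1}(q^{1/3}a,q^{-2/3}b),\quad W_i=\tilde\sigma_{i+2,-i+2}(q^{-1/3}a,q^{-1/3}b).$$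 Suppose that $t_i^3\neq q^{3k}t_j^3$ for $i\ne j$, $k\in\mathbb Z$, and that $\gamma_i=q^{(d_{i,-i+2}-d_{i+1,-i})/3}$, $\delta_i=q^{(d_{i+1,-i}-d_{i+2,-i+1})/3}$, $\epsilon_i=q^{(d_{i+2,-i+1}-d_{i,-i+2})/3}$ for $i=1,2,3$ (equalities of the chosen logarithms), where $$(\gamma_1^3,\gamma_2^3,\gamma_3^3)=\Bigl(\tfrac{a_0a_6^2}{a_1a_2^2},\tfrac{a_1a_2^2}{a_4^2a_5},\tfrac{a_4^2a_5}{a_0a_6^2}\Bigr),\ (\delta_1^3,\delta_2^3,\delta_3^3)=\Bigl(\tfrac{a_0a_2}{a_1a_6},\tfrac{a_1a_4}{a_2a_5},\tfrac{a_5a_6}{a_0a_4}\Bigr),\ (\epsilon_1^3,\epsilon_2^3,\epsilon_3^3)=\Bigl(\tfrac{a_1^2a_2}{a_0^2a_6},\tfrac{a_4a_5^2}{a_1^2a_2},\tfrac{a_0^2a_6}{a_4a_5^2}\Bigr).$$ Then $f=\dfrac{U_1V_1W_1}{U_3V_3W_3}$, $g=\dfrac{U_2V_2W_2}{U_3V_3W_3}$,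 as functions of the parameters, satisfy the $q$-Painlevé equation of type $E_6^{(1)}$ at $(a_0,\dots,a_6)$, no denominator vanishing in the successive evaluation of $\ell$. For all such $a_0,\dots,a_6$ there are balanced $(3,3)$-periodic exponents $d$ fulfilling these relations. -/

import Mathlib

/-! ### The lattice q-UC hierarchy

All functions of `t = (t_i)` with `t_i ∈ ℂ ∖ {0}` are written in the logarithmic coordinates
`θ_i` with `t_i = exp θ_i`, that is, as functions on the universal cover of the torus, and
`q = exp η`.  In this way the powers `c ^ d` (`c = exp s`, `c ^ d := exp (d * s)`) and `q ^ (1/3)`,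
`q ^ (1/2)`, … of the similarity condition are well defined for arbitrary complex `d`.
A single-valued function of `t` is the special case of a function that is `2πi`-periodic in every
`θ_i`. -/

namespace LatticeQUC

/-- The `q`-shift `T_k`: `t_k ↦ q t_k` for `k ∈ I`, and `t_k ↦ q⁻¹ t_k` for `k ∈ J`. -/
def shift {I J : Type} [DecidableEq I] [DecidableEq J] (η : ℂ) (k : I ⊕ J) (θ : I ⊕ J → ℂ) :
    I ⊕ J → ℂ :=
  Function.update θ k (θ k + Sum.elim (fun _ => η) (fun _ => -η) k)

/-- The lattice q-UC hierarchy for the unknowns `σ m n`. -/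
def Hierarchy {I J : Type} [DecidableEq I] [DecidableEq J] (η : ℂ)
    (σ : ℤ → ℤ → (I ⊕ J → ℂ) → ℂ) : Prop :=
  ∀ (m n : ℤ) (i j : I ⊕ J) (θ : I ⊕ J → ℂ),
    Complex.exp (θ i) * σ m (n + 1) (shift η i θ) * σ (m + 1) n (shift η j θ)
      - Complex.exp (θ j) * σ m (n + 1) (shift η j θ) * σ (m + 1) n (shift η i θ)
    = (Complex.exp (θ i) - Complex.exp (θ j))
        * σ m n (shift η i (shift η j θ)) * σ (m + 1) (n + 1) θ

/-- The balancing condition on the exponents of the similarity condition. -/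
def Balanced (d : ℤ → ℤ → ℂ) : Prop :=
  ∀ m n : ℤ, d m n + d (m + 1) (n + 1) = d (m + 1) n + d m (n + 1)

/-- Periodicity of order `(N₁, N₂)` of a family indexed by `ℤ × ℤ`. -/
def BiPeriodic {X : Type} (N₁ N₂ : ℤ) (u : ℤ → ℤ → X) : Prop :=
  ∀ m n : ℤ, u (m + N₁) n = u m n ∧ u m (n + N₂) = u m n

/-- The similarity condition `σ_{m,n}(c t) = c ^ d_{m,n} σ_{m,n}(t)`, with `c = exp s`. -/
def Similar {I J : Type} (d : ℤ → ℤ → ℂ) (σ : ℤ → ℤ → (I ⊕ J → ℂ) → ℂ) : Prop :=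
  ∀ (m n : ℤ) (s : ℂ) (θ : I ⊕ J → ℂ),
    σ m n (fun i => θ i + s) = Complex.exp (d m n * s) * σ m n θ

/-- The unknowns of the similarity reduction of the lattice q-UC hierarchy with periodic condition
of order `(N₁, N₂)` and exponents `d`. -/
structure IsReduction {I J : Type} [DecidableEq I] [DecidableEq J] (η : ℂ) (N₁ N₂ : ℤ)
    (d : ℤ → ℤ → ℂ) (σ : ℤ → ℤ → (I ⊕ J → ℂ) → ℂ) : Prop where
  hierarchy : Hierarchy η σ
  periodic : BiPeriodic N₁ N₂ σ
  balanced : Balanced d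
  similar : Similar d σ

/-- No `σ m n` vanishes at a point of the `q`-lattice through `θ₀`. -/
def NonvanishingAlong {I J : Type} (η : ℂ) (σ : ℤ → ℤ → (I ⊕ J → ℂ) → ℂ)
    (θ₀ : I ⊕ J → ℂ) : Prop :=
  ∀ (m n : ℤ) (k : I ⊕ J → ℤ), σ m n (fun i => θ₀ i + k i * η) ≠ 0

end LatticeQUC

/-! ### The q-Painlevé equation of type `A_{2g+1}^{(1)}` -/

namespace QPainleveA

/-- `1 + a_i f_i + a_i f_i a_{i+1} f_{i+1} + ⋯` (`N` terms). -/
noncomputable def poly (N : ℕ) (a f : ℤ → ℂ) (i : ℤ) : ℂ :=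
  ∑ k ∈ Finset.range N, ∏ l ∈ Finset.range k, a (i + l) * f (i + l)

/-- `a` is a parameter of the equation with `N = 2g+2`: the `a_i` (`i ∈ ℤ/Nℤ`) are nonzero with
product `p`, the base of the equation. -/
structure IsParam (g : ℕ) (p : ℂ) (a : ℤ → ℂ) : Prop where
  periodic : ∀ i, a (i + (2 * g + 2)) = a i
  ne_zero : ∀ i, a i ≠ 0
  prod_eq : ∏ i ∈ Finset.range (2 * g + 2), a i = p

/-- The sequence `n ↦ (f_i(n))`, `i ∈ ℤ/Nℤ`, `N = 2g+2`, solves the q-Painlevé equation of type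
`A_{2g+1}^{(1)}` with parameters `a`:
`f_i(n+1) = a_i a_{i+1} f_{i+1}(n) Q_{i+2}(n) / Q_i(n)`, under the constraint
`f_0 f_2 ⋯ f_{2g} = f_1 f_3 ⋯ f_{2g+1}`. -/
structure IsSolution (g : ℕ) (a : ℤ → ℂ) (f : ℤ → ℤ → ℂ) : Prop where
  periodic : ∀ n i, f n (i + (2 * g + 2)) = f n i
  ne_zero : ∀ n i, f n i ≠ 0
  constraint : ∀ n, ∏ j ∈ Finset.range (g + 1), f n (2 * j)
    = ∏ j ∈ Finset.range (g + 1), f n (2 * j + 1)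
  poly_ne_zero : ∀ n i, poly (2 * g + 2) a (f n) i ≠ 0
  evolution : ∀ n i, f (n + 1) i = a i * a (i + 1) * f n (i + 1)
    * poly (2 * g + 2) a (f n) (i + 2) / poly (2 * g + 2) a (f n) i

/-- The substitution for `I = {1,2}`, `J = {-1,-2}`: with `α_n = q^{n/2} α`, `α = exp a`,
`x = exp ξ`,
`(t_1, t_2) = (α_n, α_n⁻¹)`, `{t_{-1}, t_{-2}} = {-q⁻¹x, -q⁻¹x q^{∓1/2}}`
(`-` for even `m`, `+` for odd `m`), with `t_{-1} = -q⁻¹x` if `n` is even and `t_{-2} = -q⁻¹x` if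
`n` is odd. -/
noncomputable def point (η a ξ : ℂ) (m n : ℤ) : Fin 2 ⊕ Fin 2 → ℂ :=
  Sum.elim ![a + n * η / 2, -(a + n * η / 2)]
    (if Even n then
      ![Real.pi * Complex.I - η + ξ,
        Real.pi * Complex.I - η + ξ + (if Even m then -(η / 2) else η / 2)]
    else
      ![Real.pi * Complex.I - η + ξ + (if Even m then -(η / 2) else η / 2),
        Real.pi * Complex.I - η + ξ])

/-- `τ_{2j}(n)` is `σ_{-j,j}` and `τ_{2j+1}(n)` is `σ_{-j,j+1}`, at the above points. -/
noncomputable def tau (η a ξ : ℂ) (σ : ℤ → ℤ → (Fin 2 ⊕ Fin 2 → ℂ) → ℂ) (m n : ℤ) : ℂ :=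
  σ (-(m / 2)) (m / 2 + m % 2) (point η a ξ m n)

/-- The dependent variables
`f_i(n) = q^{-1/4} α_n τ_{i+2}(n) τ_i(n-1) / (τ_{i+2}(n-1) τ_i(n))`. -/
noncomputable def f (η a ξ : ℂ) (σ : ℤ → ℤ → (Fin 2 ⊕ Fin 2 → ℂ) → ℂ) (n i : ℤ) : ℂ :=
  Complex.exp (-(η / 4) + a + n * η / 2)
    * (tau η a ξ σ (i + 2) n * tau η a ξ σ i (n - 1))
    / (tau η a ξ σ (i + 2) (n - 1) * tau η a ξ σ i n)

/-- The parameters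
`a_{2j} = q^{1/4} x⁻¹ q^{(d_{-j-1,j+1} - d_{-j,j})/2}`,
`a_{2j+1} = q^{1/4} x q^{(d_{-j,j+1} - d_{-j-1,j+2})/2}`. -/
noncomputable def param (η ξ : ℂ) (d : ℤ → ℤ → ℂ) (i : ℤ) : ℂ :=
  if Even i then
    Complex.exp (η / 4 - ξ + η * (d (-(i / 2) - 1) (i / 2 + 1) - d (-(i / 2)) (i / 2)) / 2)
  else
    Complex.exp (η / 4 + ξ + η * (d (-(i / 2)) (i / 2 + 1) - d (-(i / 2) - 1) (i / 2 + 2)) / 2)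

/-- Genericity of the independent variable: `(t_1/t_2)^{g+1} ≠ 1` and `t_1, t_2 ≠ -x` for
`(t_1, t_2) = (α_n, α_n⁻¹)`, `n ∈ ℤ`. -/
def Generic (g : ℕ) (η a ξ : ℂ) : Prop :=
  ∀ n : ℤ, Complex.exp (2 * (a + n * η / 2)) ^ (g + 1) ≠ 1 ∧
    Complex.exp (a + n * η / 2) ≠ -Complex.exp ξ ∧
    Complex.exp (-(a + n * η / 2)) ≠ -Complex.exp ξ

end QPainleveA

/-! ### The q-Painlevé equation of type `D_5^{(1)}` (q-Painlevé VI) -/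

namespace QPainleveD5

/-- Parameters `(a_1, …, a_4; b_1, …, b_4)` of the q-Painlevé VI equation with base `p`. -/
structure IsParam (p : ℂ) (a b : Fin 4 → ℂ) : Prop where
  a_ne_zero : ∀ i, a i ≠ 0
  b_ne_zero : ∀ i, b i ≠ 0
  relation : b 0 * b 1 / (b 2 * b 3) = p * (a 0 * a 1 / (a 2 * a 3))

/-- The q-Painlevé VI equation in the form of Jimbo and Sakai at the time `t`, where
`(y, z)` and `(y', z')` are the values of the unknowns at `t` and at the shifted time:
`y y' / (a₃a₄) = (z' - t b₁)(z' - t b₂) / ((z' - b₃)(z' - b₄))`,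
`z z' / (b₃b₄) = (y - t a₁)(y - t a₂) / ((y - a₃)(y - a₄))`. -/
structure Equation (a b : Fin 4 → ℂ) (t y y' z z' : ℂ) : Prop where
  den_z : (z' - b 2) * (z' - b 3) ≠ 0
  den_y : (y - a 2) * (y - a 3) ≠ 0
  eq_y : y * y' / (a 2 * a 3) = (z' - t * b 0) * (z' - t * b 1) / ((z' - b 2) * (z' - b 3))
  eq_z : z * z' / (b 2 * b 3) = (y - t * a 0) * (y - t * a 1) / ((y - a 2) * (y - a 3))

/-- The substitution `(t_1, t_2, t_{-1}, t_{-2}) = (α, α⁻¹, -q⁻¹βx, -q⁻¹β⁻¹x)` with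
`α = exp a`, `β = exp b`, `x = exp ξ`. -/
noncomputable def point (η a b ξ : ℂ) : Fin 2 ⊕ Fin 2 → ℂ :=
  Sum.elim ![a, -a] ![Real.pi * Complex.I - η + b + ξ, Real.pi * Complex.I - η - b + ξ]

noncomputable def rho (η : ℂ) (σ : ℤ → ℤ → (Fin 2 ⊕ Fin 2 → ℂ) → ℂ) (m n : ℤ) (a b ξ : ℂ) : ℂ :=
  σ m n (point η a b ξ)

noncomputable def PhiMinus (η : ℂ) (σ : ℤ → ℤ → (Fin 2 ⊕ Fin 2 → ℂ) → ℂ) (a b : ℂ) (i : ℤ)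
    (ξ : ℂ) : ℂ :=
  rho η σ i i a b ξ

noncomputable def PhiPlus (η : ℂ) (σ : ℤ → ℤ → (Fin 2 ⊕ Fin 2 → ℂ) → ℂ) (a b : ℂ) (i : ℤ)
    (ξ : ℂ) : ℂ :=
  rho η σ i i (a + η / 2) (b + η / 2) ξ

noncomputable def PsiMinus (η : ℂ) (σ : ℤ → ℤ → (Fin 2 ⊕ Fin 2 → ℂ) → ℂ) (a b : ℂ) (i : ℤ)
    (ξ : ℂ) : ℂ :=
  rho η σ i (i + 1) a (b + η / 2) (ξ + η / 2)

noncomputable def PsiPlus (η : ℂ) (σ : ℤ → ℤ → (Fin 2 ⊕ Fin 2 → ℂ) → ℂ) (a b : ℂ) (i : ℤ)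
    (ξ : ℂ) : ℂ :=
  rho η σ i (i + 1) (a + η / 2) b (ξ + η / 2)

/-- `f(x)`, with `x = exp ξ`. -/
noncomputable def f (η : ℂ) (σ : ℤ → ℤ → (Fin 2 ⊕ Fin 2 → ℂ) → ℂ) (a b ξ : ℂ) : ℂ :=
  PhiPlus η σ a b 1 ξ * PhiMinus η σ a b 2 ξ / (PhiMinus η σ a b 1 ξ * PhiPlus η σ a b 2 ξ)

/-- `g(x)`, with `x = exp ξ`. -/
noncomputable def g (η : ℂ) (σ : ℤ → ℤ → (Fin 2 ⊕ Fin 2 → ℂ) → ℂ) (a b ξ : ℂ) : ℂ :=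
  PsiPlus η σ a b 1 ξ * PsiMinus η σ a b 2 ξ / (PsiMinus η σ a b 1 ξ * PsiPlus η σ a b 2 ξ)

/-- `γ = q^{(d_{1,1} - d_{1,2})/2}`. -/
noncomputable def gam (η : ℂ) (d : ℤ → ℤ → ℂ) : ℂ := Complex.exp (η * (d 1 1 - d 1 2) / 2)

/-- `δ = q^{(d_{2,1} - d_{1,1})/2}`. -/
noncomputable def del (η : ℂ) (d : ℤ → ℤ → ℂ) : ℂ := Complex.exp (η * (d 2 1 - d 1 1) / 2)

/-- The symmetric form of the q-Painlevé VI equation at `x`; here `f = f(x)`, `fUp = f(qx)`,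
`g = g(x)`, `gDown = g(q⁻¹x)`. -/
structure SymmetricEquation (q α β γ δ x f fUp g gDown : ℂ) : Prop where
  den_g : (x * g + α * β * γ * δ) * (q * x * g + α⁻¹ * β⁻¹ * γ⁻¹ * δ⁻¹) ≠ 0
  den_f : (x * f + α * β⁻¹ * γ⁻¹ * δ) * (x * f + α⁻¹ * β * γ * δ⁻¹) ≠ 0
  eq_f : fUp * f =
    (g + α⁻¹ * β⁻¹ * γ * δ * x) * (g + α * β * γ⁻¹ * δ⁻¹ * q * x)
      / ((x * g + α * β * γ * δ) * (q * x * g + α⁻¹ * β⁻¹ * γ⁻¹ * δ⁻¹))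
  eq_g : gDown * g =
    (f + α⁻¹ * β * γ⁻¹ * δ * x) * (f + α * β⁻¹ * γ * δ⁻¹ * x)
      / ((x * f + α * β⁻¹ * γ⁻¹ * δ) * (x * f + α⁻¹ * β * γ * δ⁻¹))

/-- The Jimbo–Sakai parameters `a_i` that correspond to `(α, β, γ, δ)`. -/
noncomputable def paramA (α β γ δ : ℂ) : Fin 4 → ℂ :=
  ![-(α⁻¹ * β * γ⁻¹ * δ), -(α * β⁻¹ * γ * δ⁻¹), -(α * β⁻¹ * γ⁻¹ * δ), -(α⁻¹ * β * γ * δ⁻¹)]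

/-- The Jimbo–Sakai parameters `b_i` that correspond to `(α, β, γ, δ)`. -/
noncomputable def paramB (q α β γ δ : ℂ) : Fin 4 → ℂ :=
  ![-(α⁻¹ * β⁻¹ * γ * δ), -(α * β * γ⁻¹ * δ⁻¹ * q), -(α * β * γ * δ),
    -(α⁻¹ * β⁻¹ * γ⁻¹ * δ⁻¹ * q⁻¹)]

/-- Effect on `(a_1, …, a_4)` (or `(b_1, …, b_4)`) of the rescaling `y ↦ l y` (or `z ↦ l z`) and
`t ↦ k t` of the variables of the q-Painlevé VI equation. -/
noncomputable def rescale (l k : ℂ) (a : Fin 4 → ℂ) : Fin 4 → ℂ :=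
  ![l / k * a 0, l / k * a 1, l * a 2, l * a 3]

/-- Genericity of the independent variable: `t_i ≠ q^k t_j` for `i ∈ I`, `j ∈ J`, `k ∈ ℤ`. -/
def Generic (η a b ξ : ℂ) : Prop :=
  ∀ (i j : Fin 2) (k : ℤ),
    Complex.exp (point η a b ξ (Sum.inl i)) ≠ Complex.exp (point η a b ξ (Sum.inr j) + k * η)

end QPainleveD5

/-! ### The q-Painlevé equation of type `E_6^{(1)}` -/

namespace QPainleveE6

/-- The Cartan matrix of type `E_6^{(1)}`; the edges of the Dynkin diagram are
`1-2`, `2-3`, `3-4`, `4-5`, `3-6`, `6-0`. -/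
def cartan : Matrix (Fin 7) (Fin 7) ℤ :=
  !![ 2,  0,  0,  0,  0,  0, -1;
      0,  2, -1,  0,  0,  0,  0;
      0, -1,  2, -1,  0,  0,  0;
      0,  0, -1,  2, -1,  0, -1;
      0,  0,  0, -1,  2, -1,  0;
      0,  0,  0,  0, -1,  2,  0;
     -1,  0,  0, -1,  0,  0,  2]

/-- A point `(κ, (f, g))` of the space on which the Weyl group acts birationally, where
`κ_i = a_i^{1/3}` are third roots of the multiplicative root variables `a_i`. -/
abbrev State : Type := (Fin 7 → ℂ) × ℂ × ℂ

noncomputable def cx (κ : Fin 7 → ℂ) : ℂ := κ 1 * κ 2 ^ 2 / (κ 4 ^ 2 * κ 5)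

noncomputable def cy (κ : Fin 7 → ℂ) : ℂ := κ 5 * κ 4 ^ 2 / (κ 6 ^ 2 * κ 0)

noncomputable def cz (κ : Fin 7 → ℂ) : ℂ := κ 0 * κ 6 ^ 2 / (κ 2 ^ 2 * κ 1)

/-- The common denominator of `s_3(f)` and `s_3(g)`. -/
noncomputable def den (s : State) : ℂ :=
  (s.1 3 ^ 3)⁻¹ * cx s.1 * s.2.1 + s.1 3 ^ 3 * cy s.1 * s.2.2 + cz s.1

/-- The birational map `P ↦ (s_i(a)^{1/3}, s_i(f), s_i(g))(P)` of the simple reflection `s_i`: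
`s_i(a_j) = a_j a_i^{-C_{ij}}`, and only `s_3` acts nontrivially on `(f, g)`. -/
noncomputable def act (i : Fin 7) (s : State) : State :=
  (fun j => s.1 j * s.1 i ^ (-(cartan i j)),
    if i = 3 then
      (s.2.1 * (cx s.1 * s.2.1 + (s.1 3 ^ 3)⁻¹ * cy s.1 * s.2.2 + s.1 3 ^ 3 * cz s.1) / den s,
       s.2.2 * (s.1 3 ^ 3 * cx s.1 * s.2.1 + cy s.1 * s.2.2 + (s.1 3 ^ 3)⁻¹ * cz s.1) / den s)
    else s.2)

/-- The value at a point of the rational functions `w(a_j)^{1/3}`, `w(f)`, `w(g)` for a word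
`w = s_{i₁} s_{i₂} ⋯ s_{iₖ}`.  A word acts on a rational function by applying first `s_{i₁}`, then
`s_{i₂}`, and so on, so the point is moved first by the map of `s_{iₖ}`. -/
noncomputable def run (w : List (Fin 7)) (s : State) : State := w.foldr act s

/-- No denominator vanishes in the evaluation of `run w s`. -/
def Defined : List (Fin 7) → State → Prop
  | [], _ => True
  | i :: w, s => Defined w s ∧ (i = 3 → den (run w s) ≠ 0)

/-- The translation `ℓ = (s_2 s_4 s_6 s_0 s_1 s_5 s_3 s_2 s_4 s_6 s_3)²`. -/
def ell : List (Fin 7) :=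
  [2, 4, 6, 0, 1, 5, 3, 2, 4, 6, 3, 2, 4, 6, 0, 1, 5, 3, 2, 4, 6, 3]

/-- Logarithms `A_i` of the parameters `a_i = exp A_i`, normalized by
`a_0 a_1 a_2² a_3³ a_4² a_5 a_6² = q`. -/
def IsParam (η : ℂ) (A : Fin 7 → ℂ) : Prop :=
  A 0 + A 1 + 2 * A 2 + 3 * A 3 + 2 * A 4 + A 5 + 2 * A 6 = η

/-- The `q`-shift `(a_0, a_1, q⁻¹a_2, q²a_3, q⁻¹a_4, a_5, q⁻¹a_6)` of the parameters. -/
noncomputable def bar (η : ℂ) (A : Fin 7 → ℂ) : Fin 7 → ℂ :=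
  ![A 0, A 1, A 2 - η, A 3 + 2 * η, A 4 - η, A 5, A 6 - η]

/-- The third roots `a_i^{1/3}`. -/
noncomputable def roots (A : Fin 7 → ℂ) : Fin 7 → ℂ := fun i => Complex.exp (A i / 3)

/-- The q-Painlevé equation of type `E_6^{(1)}` at the parameter `a = exp A`, for functions `f`, `g`
of the parameters: the rational functions `ℓ(f)`, `ℓ(g)` are defined at `(a; f(a), g(a))`, their
values are `f(ā)`, `g(ā)`, and `ℓ(a) = ā`. -/
def SolvesAt (η : ℂ) (f g : (Fin 7 → ℂ) → ℂ) (A : Fin 7 → ℂ) : Prop :=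
  Defined ell (roots A, f A, g A) ∧
    run ell (roots A, f A, g A) = (roots (bar η A), f (bar η A), g (bar η A))

/-- The substitution `(t_1, t_2, t_3) = (a⁻¹, b⁻¹, ab)`, for logarithms `u`, `v` of `a`, `b`;
`I = {1,2,3}`, `J = ∅`. -/
noncomputable def point (u v : ℂ) : Fin 3 ⊕ Empty → ℂ :=
  Sum.elim ![-u, -v, u + v] Empty.elim

/-- The logarithm of `a = (a_0 a_1 a_5)^{1/3}`. -/
noncomputable def logA (A : Fin 7 → ℂ) : ℂ := (A 0 + A 1 + A 5) / 3

/-- The logarithm of `b = (a_2 a_4 a_6 q)^{1/3}`. -/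
noncomputable def logB (η : ℂ) (A : Fin 7 → ℂ) : ℂ := (A 2 + A 4 + A 6 + η) / 3

noncomputable def U (σ : ℤ → ℤ → (Fin 3 ⊕ Empty → ℂ) → ℂ) (i : ℤ) (u v : ℂ) : ℂ :=
  σ i (-i) (point u v)

noncomputable def V (η : ℂ) (σ : ℤ → ℤ → (Fin 3 ⊕ Empty → ℂ) → ℂ) (i : ℤ) (u v : ℂ) : ℂ :=
  σ (i + 1) (-i + 1) (point (u + η / 3) (v - 2 * η / 3))

noncomputable def W (η : ℂ) (σ : ℤ → ℤ → (Fin 3 ⊕ Empty → ℂ) → ℂ) (i : ℤ) (u v : ℂ) : ℂ :=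
  σ (i + 2) (-i + 2) (point (u - η / 3) (v - η / 3))

/-- `f = U₁V₁W₁ / (U₃V₃W₃)` as a function of the parameters. -/
noncomputable def f (η : ℂ) (σ : ℤ → ℤ → (Fin 3 ⊕ Empty → ℂ) → ℂ) (A : Fin 7 → ℂ) : ℂ :=
  U σ 1 (logA A) (logB η A) * V η σ 1 (logA A) (logB η A) * W η σ 1 (logA A) (logB η A)
    / (U σ 3 (logA A) (logB η A) * V η σ 3 (logA A) (logB η A) * W η σ 3 (logA A) (logB η A))

/-- `g = U₂V₂W₂ / (U₃V₃W₃)` as a function of the parameters. -/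
noncomputable def g (η : ℂ) (σ : ℤ → ℤ → (Fin 3 ⊕ Empty → ℂ) → ℂ) (A : Fin 7 → ℂ) : ℂ :=
  U σ 2 (logA A) (logB η A) * V η σ 2 (logA A) (logB η A) * W η σ 2 (logA A) (logB η A)
    / (U σ 3 (logA A) (logB η A) * V η σ 3 (logA A) (logB η A) * W η σ 3 (logA A) (logB η A))

/-- The correspondence of parameters and exponents:
`γ_i = q^{(d_{i,-i+2} - d_{i+1,-i})/3}`, `δ_i = q^{(d_{i+1,-i} - d_{i+2,-i+1})/3}`,
`ε_i = q^{(d_{i+2,-i+1} - d_{i,-i+2})/3}` for `i = 1, 2, 3`, where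
`γ_1 = (a_0 a_6² / (a_1 a_2²))^{1/3}`, `δ_1 = (a_0 a_2 / (a_1 a_6))^{1/3}`,
`ε_1 = (a_1² a_2 / (a_0² a_6))^{1/3}`, and so on; in logarithms, multiplied by `3`. -/
structure Corresponds (η : ℂ) (d : ℤ → ℤ → ℂ) (A : Fin 7 → ℂ) : Prop where
  gam1 : A 0 + 2 * A 6 - A 1 - 2 * A 2 = η * (d 1 1 - d 2 (-1))
  gam2 : A 1 + 2 * A 2 - 2 * A 4 - A 5 = η * (d 2 0 - d 3 (-2))
  gam3 : 2 * A 4 + A 5 - A 0 - 2 * A 6 = η * (d 3 (-1) - d 4 (-3))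
  del1 : A 0 + A 2 - A 1 - A 6 = η * (d 2 (-1) - d 3 0)
  del2 : A 1 + A 4 - A 2 - A 5 = η * (d 3 (-2) - d 4 (-1))
  del3 : A 5 + A 6 - A 0 - A 4 = η * (d 4 (-3) - d 5 (-2))
  eps1 : 2 * A 1 + A 2 - 2 * A 0 - A 6 = η * (d 3 0 - d 1 1)
  eps2 : A 4 + 2 * A 5 - 2 * A 1 - A 2 = η * (d 4 (-1) - d 2 0)
  eps3 : 2 * A 0 + A 6 - A 4 - 2 * A 5 = η * (d 5 (-2) - d 3 (-1))

/-- Genericity of the independent variables: `t_i³ ≠ q^{3k} t_j³` for `i ≠ j`, `k ∈ ℤ`. -/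
def Generic (η u v : ℂ) : Prop :=
  ∀ (i j : Fin 3) (k : ℤ), i ≠ j →
    Complex.exp (3 * point u v (Sum.inl i)) ≠ Complex.exp (3 * (point u v (Sum.inl j) + k * η))

end QPainleveE6

/-! ### Similarity, nonvanishing, and elimination in the hierarchy -/

namespace LatticeQUC

open Complex

/-! Similarity makes the values of each `σ m n` on the `q`-lattice known, up to explicit factors, at
all common rescalings of that lattice; periodicity leaves finitely many indices. The hierarchy thus
becomes a finite set of bilinear relations between tau functions at neighbouring points, whose
coefficients contain powers of `q` built from differences of exponents. These powers are the
parameters of the Painlevé equations. In each type the dependent variables are quotients of tau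
functions, chosen so that the factors in the Painlevé equation are monomials in tau functions.

Type A. Eliminating one unknown from three equations of the hierarchy (`Hierarchy.cyclic_succ_left`,
`Hierarchy.cyclic_succ_right`) gives three-term relations between `τ_i` and `τ_{i+1}` at `n - 1`,
`n`, `n + 1`. Divided by `τ_i(n) τ_{i+1}(n)` and normalized, they read `X_i - a_i f_i X_{i+1} = c`
with `c` independent of `i` (`cyclicSol_sub`). Iteration around the cycle gives `(1 - α_n^{2(g+1)})
X_i = c Q_i`, so every `Q_i` is the same nonzero constant times a monomial in tau functions
(`poly_eq`), and the evolution equation is an identity between such monomials.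

Type D. Each of the eight factors `g + const`, `xg + const`, `f + const`, `xf + const` is, over the
denominator of `g` or `f`, one side of a bilinear relation (`bilinear_Psi`, `bilinear_Phi`) whose
other side is a single product. Multiplying the four relations of a group gives each equation of the
symmetric form; the Jimbo–Sakai form is a change of variables.

Type E. The translation `ℓ` contains four letters `s_3`, separated by reflections that only move
parameters. Three bilinear relations say that `s_3` replaces one of the three tau factors in `f` and
`g` by its value at another point (`act_three_of_bilinear`, `act_three_of_diag`). The replacements
are made in `U`, `V`, `W`, `V`, and the outcome is `(f, g)` at the shifted parameters
(`solvesAt_f_g`).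

Conversely, balanced periodic exponents of the form `u(m) + v(n)` are found for given parameters by
solving linear equations for logarithms. -/

theorem IsReduction.similar' {I J : Type} [DecidableEq I] [DecidableEq J] {η : ℂ} {N₁ N₂ : ℤ}
    {d : ℤ → ℤ → ℂ} {σ : ℤ → ℤ → (I ⊕ J → ℂ) → ℂ} (h : IsReduction η N₁ N₂ d σ) (m n : ℤ)
    {θ θ' : I ⊕ J → ℂ} (s : ℂ) (hθ : ∀ i, θ' i = θ i + s) :
    σ m n θ' = exp (d m n * s) * σ m n θ := by
  rw [← h.similar m n s θ]
  exact congrArg _ (funext hθ)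

/-- Similarity carries nonvanishing from the `q`-lattice to all its common rescalings. Points
displaced by `q^{1/2}` or `q^{1/3}` are reached in this way. -/
theorem NonvanishingAlong.ne_zero {I J : Type} [DecidableEq I] [DecidableEq J] {η : ℂ}
    {N₁ N₂ : ℤ} {d : ℤ → ℤ → ℂ} {σ : ℤ → ℤ → (I ⊕ J → ℂ) → ℂ} {θ₀ : I ⊕ J → ℂ}
    (hσ : NonvanishingAlong η σ θ₀) (h : IsReduction η N₁ N₂ d σ) (m n : ℤ)
    (k : I ⊕ J → ℤ) (s : ℂ) {θ : I ⊕ J → ℂ} (hθ : ∀ i, θ i = θ₀ i + k i * η + s) :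
    σ m n θ ≠ 0 := by
  rw [h.similar' m n (θ := fun i => θ₀ i + k i * η) s hθ]
  exact mul_ne_zero (exp_ne_zero _) (hσ m n k)

/-- If `c ≠ c'`, the choice `s = (c - c')⁻¹` would give `exp 1 = 1`. -/
theorem eq_of_exp_mul_eq {c c' : ℂ} (h : ∀ s, exp (c * s) = exp (c' * s)) : c = c' := by
  by_contra hne
  have hne' : c - c' ≠ 0 := sub_ne_zero.2 hne
  have h1 : exp 1 = 1 := by
    have h2 := h (c - c')⁻¹
    have h3 : exp ((c - c') * (c - c')⁻¹) = 1 := by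
      rw [sub_mul, exp_sub, h2, div_self (exp_ne_zero _)]
    rwa [mul_inv_cancel₀ hne'] at h3
  have h4 := congrArg norm h1
  rw [norm_exp, one_re, norm_one, Real.exp_eq_one_iff] at h4
  exact one_ne_zero h4

/-- The exponents of a similarity solution inherit its periodicity. -/
theorem IsReduction.biPeriodic_exponents {I J : Type} [DecidableEq I] [DecidableEq J] {η : ℂ}
    {N₁ N₂ : ℤ} {d : ℤ → ℤ → ℂ} {σ : ℤ → ℤ → (I ⊕ J → ℂ) → ℂ} {θ₀ : I ⊕ J → ℂ}
    (h : IsReduction η N₁ N₂ d σ) (hσ : NonvanishingAlong η σ θ₀) : BiPeriodic N₁ N₂ d := by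
  intro m n
  have h0 : ∀ m n, σ m n θ₀ ≠ 0 := fun m n =>
    hσ.ne_zero h m n 0 0 (by intro i; simp)
  constructor
  · refine eq_of_exp_mul_eq fun s => ?_
    have h1 := h.similar (m + N₁) n s θ₀
    rw [(h.periodic m n).1, h.similar m n s θ₀] at h1
    exact (mul_right_cancel₀ (h0 m n) h1).symm
  · refine eq_of_exp_mul_eq fun s => ?_
    have h1 := h.similar m (n + N₂) s θ₀
    rw [(h.periodic m n).2, h.similar m n s θ₀] at h1
    exact (mul_right_cancel₀ (h0 m n) h1).symm

/-- Elimination of `σ_{m,n+1}` from the hierarchy. -/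
theorem Hierarchy.cyclic_succ_left {I J : Type} [DecidableEq I] [DecidableEq J] {η : ℂ}
    {σ : ℤ → ℤ → (I ⊕ J → ℂ) → ℂ} (h : Hierarchy η σ) (m n : ℤ) (i j k : I ⊕ J)
    (θ : I ⊕ J → ℂ) (h0 : σ (m + 1) (n + 1) θ ≠ 0) :
    (exp (θ i) - exp (θ j)) * σ m n (shift η i (shift η j θ)) * σ (m + 1) n (shift η k θ)
      + (exp (θ j) - exp (θ k)) * σ m n (shift η j (shift η k θ)) * σ (m + 1) n (shift η i θ)
      + (exp (θ k) - exp (θ i)) * σ m n (shift η k (shift η i θ)) * σ (m + 1) n (shift η j θ)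
      = 0 := by
  refine mul_right_cancel₀ h0 ?_
  -- With these weights every `t_i T_i(σ_{m,n+1})` occurs in two of the three equations with the
  -- same cofactor and opposite signs, so only the right sides survive; they share the factor
  -- `σ_{m+1,n+1}(θ)`.
  linear_combination -(σ (m + 1) n (shift η k θ)) * h m n i j θ
    - σ (m + 1) n (shift η i θ) * h m n j k θ - σ (m + 1) n (shift η j θ) * h m n k i θ

/-- Elimination of `σ_{m+1,n}` from the hierarchy. -/
theorem Hierarchy.cyclic_succ_right {I J : Type} [DecidableEq I] [DecidableEq J] {η : ℂ}
    {σ : ℤ → ℤ → (I ⊕ J → ℂ) → ℂ} (h : Hierarchy η σ) (m n : ℤ) (i j k : I ⊕ J)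
    (θ : I ⊕ J → ℂ) (h0 : σ (m + 1) (n + 1) θ ≠ 0) :
    (exp (θ i) - exp (θ j)) * exp (θ k) * σ m n (shift η i (shift η j θ))
        * σ m (n + 1) (shift η k θ)
      + (exp (θ j) - exp (θ k)) * exp (θ i) * σ m n (shift η j (shift η k θ))
        * σ m (n + 1) (shift η i θ)
      + (exp (θ k) - exp (θ i)) * exp (θ j) * σ m n (shift η k (shift η i θ))
        * σ m (n + 1) (shift η j θ)
      = 0 := by
  refine mul_right_cancel₀ h0 ?_
  linear_combination -(exp (θ k) * σ m (n + 1) (shift η k θ)) * h m n i j θ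
    - exp (θ i) * σ m (n + 1) (shift η i θ) * h m n j k θ
    - exp (θ j) * σ m (n + 1) (shift η j θ) * h m n k i θ

/-- Logarithmic coordinates `(x₁, x₂, y₁, y₂)` for `I = {1,2}`, `J = {-1,-2}`. -/
def pt (x₁ x₂ y₁ y₂ : ℂ) : Fin 2 ⊕ Fin 2 → ℂ := Sum.elim ![x₁, x₂] ![y₁, y₂]

theorem forall_sum_fin_two {p : Fin 2 ⊕ Fin 2 → Prop} :
    (∀ i, p i) ↔ p (.inl 0) ∧ p (.inl 1) ∧ p (.inr 0) ∧ p (.inr 1) := by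
  rw [Sum.forall, Fin.forall_fin_two, Fin.forall_fin_two, and_assoc]

theorem pt_congr {x₁ x₂ y₁ y₂ x₁' x₂' y₁' y₂' : ℂ} (h₁ : x₁ = x₁') (h₂ : x₂ = x₂')
    (h₃ : y₁ = y₁') (h₄ : y₂ = y₂') : pt x₁ x₂ y₁ y₂ = pt x₁' x₂' y₁' y₂' := by
  rw [h₁, h₂, h₃, h₄]

variable (η x₁ x₂ y₁ y₂ : ℂ)

@[simp] theorem pt_inl_zero : pt x₁ x₂ y₁ y₂ (.inl 0) = x₁ := rfl
@[simp] theorem pt_inl_one : pt x₁ x₂ y₁ y₂ (.inl 1) = x₂ := rfl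
@[simp] theorem pt_inr_zero : pt x₁ x₂ y₁ y₂ (.inr 0) = y₁ := rfl
@[simp] theorem pt_inr_one : pt x₁ x₂ y₁ y₂ (.inr 1) = y₂ := rfl

@[simp] theorem shift_pt_inl_zero :
    shift η (.inl 0) (pt x₁ x₂ y₁ y₂) = pt (x₁ + η) x₂ y₁ y₂ := by
  funext i; revert i; rw [forall_sum_fin_two]; simp [shift]

@[simp] theorem shift_pt_inl_one :
    shift η (.inl 1) (pt x₁ x₂ y₁ y₂) = pt x₁ (x₂ + η) y₁ y₂ := by
  funext i; revert i; rw [forall_sum_fin_two]; simp [shift]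

@[simp] theorem shift_pt_inr_zero :
    shift η (.inr 0) (pt x₁ x₂ y₁ y₂) = pt x₁ x₂ (y₁ - η) y₂ := by
  funext i; revert i; rw [forall_sum_fin_two]; simp [shift, sub_eq_add_neg]

@[simp] theorem shift_pt_inr_one :
    shift η (.inr 1) (pt x₁ x₂ y₁ y₂) = pt x₁ x₂ y₁ (y₂ - η) := by
  funext i; revert i; rw [forall_sum_fin_two]; simp [shift, sub_eq_add_neg]

variable {η x₁ x₂ y₁ y₂} {N₁ N₂ : ℤ} {d : ℤ → ℤ → ℂ} {σ : ℤ → ℤ → (Fin 2 ⊕ Fin 2 → ℂ) → ℂ}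

theorem IsReduction.similar_pt (h : IsReduction η N₁ N₂ d σ) (m n : ℤ)
    {x₁' x₂' y₁' y₂' : ℂ} (s : ℂ) (h₁ : x₁' = x₁ + s) (h₂ : x₂' = x₂ + s) (h₃ : y₁' = y₁ + s)
    (h₄ : y₂' = y₂ + s) :
    σ m n (pt x₁' x₂' y₁' y₂') = exp (d m n * s) * σ m n (pt x₁ x₂ y₁ y₂) :=
  h.similar' m n s (forall_sum_fin_two.2 ⟨h₁, h₂, h₃, h₄⟩)

theorem NonvanishingAlong.ne_zero_pt (hσ : NonvanishingAlong η σ (pt x₁ x₂ y₁ y₂))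
    (h : IsReduction η N₁ N₂ d σ) (m n : ℤ) (k₁ k₂ l₁ l₂ : ℤ) (s : ℂ) {x₁' x₂' y₁' y₂' : ℂ}
    (h₁ : x₁' = x₁ + k₁ * η + s) (h₂ : x₂' = x₂ + k₂ * η + s) (h₃ : y₁' = y₁ + l₁ * η + s)
    (h₄ : y₂' = y₂ + l₂ * η + s) :
    σ m n (pt x₁' x₂' y₁' y₂') ≠ 0 :=
  hσ.ne_zero h m n (Sum.elim ![k₁, k₂] ![l₁, l₂]) s (forall_sum_fin_two.2 ⟨h₁, h₂, h₃, h₄⟩)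

end LatticeQUC

/-! ### Type D: the eight bilinear relations -/

namespace QPainleveD5

open Complex LatticeQUC

theorem point_eq_pt (η a b ξ : ℂ) : point η a b ξ =
    pt a (-a) (Real.pi * I - η + b + ξ) (Real.pi * I - η - b + ξ) := rfl

/-- `-exp ζ`, with the logarithm shifted by `πi`. -/
theorem exp_pi_mul_I_add (ζ : ℂ) : exp (Real.pi * I + ζ) = -exp ζ := by
  rw [exp_add, exp_pi_mul_I, neg_one_mul]

section

variable {η : ℂ} {d : ℤ → ℤ → ℂ} {σ : ℤ → ℤ → (Fin 2 ⊕ Fin 2 → ℂ) → ℂ}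

/-- The equations of the hierarchy for `(m, n) = (1,1), (2,2), (1,2), (2,1)`. -/
theorem hierarchy_two_two (h : IsReduction η 2 2 d σ) (i j : Fin 2 ⊕ Fin 2)
    (θ : Fin 2 ⊕ Fin 2 → ℂ) :
    (exp (θ i) * σ 1 2 (shift η i θ) * σ 2 1 (shift η j θ)
      - exp (θ j) * σ 1 2 (shift η j θ) * σ 2 1 (shift η i θ)
      = (exp (θ i) - exp (θ j)) * σ 1 1 (shift η i (shift η j θ)) * σ 2 2 θ) ∧
    (exp (θ i) * σ 2 1 (shift η i θ) * σ 1 2 (shift η j θ)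
      - exp (θ j) * σ 2 1 (shift η j θ) * σ 1 2 (shift η i θ)
      = (exp (θ i) - exp (θ j)) * σ 2 2 (shift η i (shift η j θ)) * σ 1 1 θ) ∧
    (exp (θ i) * σ 1 1 (shift η i θ) * σ 2 2 (shift η j θ)
      - exp (θ j) * σ 1 1 (shift η j θ) * σ 2 2 (shift η i θ)
      = (exp (θ i) - exp (θ j)) * σ 1 2 (shift η i (shift η j θ)) * σ 2 1 θ) ∧
    (exp (θ i) * σ 2 2 (shift η i θ) * σ 1 1 (shift η j θ)
      - exp (θ j) * σ 2 2 (shift η j θ) * σ 1 1 (shift η i θ)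
      = (exp (θ i) - exp (θ j)) * σ 2 1 (shift η i (shift η j θ)) * σ 1 2 θ) := by
  have p13 : σ 1 (2 + 1) = σ 1 1 := (h.periodic 1 1).2
  have p23 : σ 2 (2 + 1) = σ 2 1 := (h.periodic 2 1).2
  have p31 : σ (2 + 1) 1 = σ 1 1 := (h.periodic 1 1).1
  have p32 : σ (2 + 1) 2 = σ 1 2 := (h.periodic 1 2).1
  have p33 : σ (2 + 1) (2 + 1) = σ 1 1 := ((h.periodic 1 3).1).trans p13
  have e11 := h.hierarchy 1 1 i j θ
  have e22 := h.hierarchy 2 2 i j θ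
  have e12 := h.hierarchy 1 2 i j θ
  have e21 := h.hierarchy 2 1 i j θ
  rw [p23, p32, p33] at e22
  rw [one_add_one_eq_two] at e11 e12 e21
  rw [p13, p23] at e12
  rw [p31, p32] at e21
  exact ⟨e11, e22, e12, e21⟩

theorem PsiPlus_two (h : IsReduction η 2 2 d σ) (a b ξ : ℂ) :
    PsiPlus η σ a b 2 ξ = rho η σ 2 1 (a + η / 2) b (ξ + η / 2) := by
  have p23 : σ 2 (2 + 1) = σ 2 1 := (h.periodic 2 1).2
  rw [PsiPlus, rho, p23, rho]

theorem PsiMinus_two (h : IsReduction η 2 2 d σ) (a b ξ : ℂ) :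
    PsiMinus η σ a b 2 ξ = rho η σ 2 1 a (b + η / 2) (ξ + η / 2) := by
  have p23 : σ 2 (2 + 1) = σ 2 1 := (h.periodic 2 1).2
  rw [PsiMinus, rho, p23, rho]

/-- This and the next two lemmas express all four scaling factors of a half step through the one
with index `(1, 2)`, which then cancels from every bilinear relation. Only `γ` and `δ` remain; for
the index `(2, 2)` this needs the balancing condition. -/
theorem exp_mul_gam : exp (d 1 2 * (η / 2)) * gam η d = exp (d 1 1 * (η / 2)) := by
  rw [gam, ← exp_add]; congr 1; ring

theorem exp_mul_del : exp (d 1 1 * (η / 2)) * del η d = exp (d 2 1 * (η / 2)) := by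
  rw [del, ← exp_add]; congr 1; ring

theorem exp_mul_del' (h : Balanced d) :
    exp (d 1 2 * (η / 2)) * del η d = exp (d 2 2 * (η / 2)) := by
  have hb := h 1 1
  rw [one_add_one_eq_two] at hb
  have hd : d 2 2 = d 2 1 + d 1 2 - d 1 1 := by linear_combination hb
  rw [del, ← exp_add, hd]; congr 1; ring

variable (a b ξ : ℂ)

/-- The four bilinear relations between `Ψ(x)` and `Φ(x)`, `Φ(qx)`. -/
theorem bilinear_Psi (h : IsReduction η 2 2 d σ) :
    (PsiPlus η σ a b 1 ξ * PsiMinus η σ a b 2 ξ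
      + (exp a)⁻¹ * (exp b)⁻¹ * gam η d * del η d * exp ξ
        * (PsiMinus η σ a b 1 ξ * PsiPlus η σ a b 2 ξ)
      = (1 + (exp a)⁻¹ * (exp b)⁻¹ * exp ξ) * gam η d
        * (PhiPlus η σ a b 1 ξ * PhiMinus η σ a b 2 (ξ + η))) ∧
    (exp ξ * (PsiPlus η σ a b 1 ξ * PsiMinus η σ a b 2 ξ)
      + exp a * exp b * gam η d * del η d * (PsiMinus η σ a b 1 ξ * PsiPlus η σ a b 2 ξ)
      = (exp a * exp b + exp ξ) * del η d
        * (PhiPlus η σ a b 2 ξ * PhiMinus η σ a b 1 (ξ + η))) ∧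
    (exp η * exp ξ * (PsiPlus η σ a b 1 ξ * PsiMinus η σ a b 2 ξ)
      + (exp a)⁻¹ * (exp b)⁻¹ * (gam η d)⁻¹ * (del η d)⁻¹
        * (PsiMinus η σ a b 1 ξ * PsiPlus η σ a b 2 ξ)
      = ((exp a)⁻¹ * (exp b)⁻¹ + exp η * exp ξ) * (del η d)⁻¹
        * (PhiMinus η σ a b 1 ξ * PhiPlus η σ a b 2 (ξ + η))) ∧
    (PsiPlus η σ a b 1 ξ * PsiMinus η σ a b 2 ξ
      + exp a * exp b * (gam η d)⁻¹ * (del η d)⁻¹ * exp η * exp ξ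
        * (PsiMinus η σ a b 1 ξ * PsiPlus η σ a b 2 ξ)
      = (1 + exp a * exp b * exp η * exp ξ) * (gam η d)⁻¹
        * (PhiMinus η σ a b 2 ξ * PhiPlus η σ a b 1 (ξ + η))) := by
  set c : ℂ := Real.pi * I - η with hc
  have e1 : exp (c - b + ξ + η) = -((exp b)⁻¹ * exp ξ) := by
    rw [← exp_neg, ← exp_add, ← exp_pi_mul_I_add]; congr 1; rw [hc]; ring
  have e2 : exp (c + b + ξ + η) = -(exp b * exp ξ) := by
    rw [← exp_add, ← exp_pi_mul_I_add]; congr 1; rw [hc]; ring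
  have e3 : exp (-a - η) = (exp a)⁻¹ * (exp η)⁻¹ := by
    rw [← exp_neg, ← exp_neg, ← exp_add]; congr 1
  have hPp : ∀ m n, σ m n (pt (a + η) (-a) (c + b + ξ + η) (c - b + ξ + η))
      = exp (d m n * (η / 2)) * rho η σ m n (a + η / 2) b (ξ + η / 2) := fun m n =>
    h.similar_pt m n (η / 2) (by ring) (by ring) (by rw [hc]; ring) (by rw [hc]; ring)
  have hPp' : ∀ m n, σ m n (pt a (-a - η) (c + b + ξ) (c - b + ξ))
      = exp (d m n * (-(η / 2))) * rho η σ m n (a + η / 2) b (ξ + η / 2) := fun m n =>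
    h.similar_pt m n (-(η / 2)) (by ring) (by ring) (by rw [hc]; ring) (by rw [hc]; ring)
  have hPm : ∀ m n, σ m n (pt a (-a) (c + b + ξ + η) (c - b + ξ))
      = rho η σ m n a (b + η / 2) (ξ + η / 2) := fun m n =>
    congrArg _ (pt_congr rfl rfl (by rw [hc]; ring) (by rw [hc]; ring))
  have hFp : ∀ m n, σ m n (pt (a + η) (-a) (c + b + ξ + η) (c - b + ξ))
      = exp (d m n * (η / 2)) * rho η σ m n (a + η / 2) (b + η / 2) ξ := fun m n =>
    h.similar_pt m n (η / 2) (by ring) (by ring) (by rw [hc]; ring) (by rw [hc]; ring)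
  have hFp' : ∀ m n, σ m n (pt a (-a - η) (c + b + ξ + η) (c - b + ξ))
      = exp (d m n * (-(η / 2))) * rho η σ m n (a + η / 2) (b + η / 2) (ξ + η) := fun m n =>
    h.similar_pt m n (-(η / 2)) (by ring) (by ring) (by rw [hc]; ring) (by rw [hc]; ring)
  have hFm : ∀ m n, σ m n (pt a (-a) (c + b + ξ + η) (c - b + ξ + η))
      = rho η σ m n a b (ξ + η) := fun m n =>
    congrArg _ (pt_congr rfl rfl (by rw [hc]; ring) (by rw [hc]; ring))
  have hFm' : ∀ m n, σ m n (pt a (-a) (c + b + ξ) (c - b + ξ))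
      = rho η σ m n a b ξ := fun m n => rfl
  -- Up to a common scaling, the base points are those of `Φ⁻(qx)` and `Φ⁺(qx)`. The double shifts
  -- `T_1T_{-2}` and `T_2T_{-1}` lead to `Φ⁺(x)` and `Φ⁻(x)`, and the single shifts to `Ψ⁺(x)` and
  -- `Ψ⁻(x)`.
  obtain ⟨E1, E2, -, -⟩ := hierarchy_two_two h (.inl 0) (.inr 1)
    (pt a (-a) (c + b + ξ + η) (c - b + ξ + η))
  obtain ⟨E3, E4, -, -⟩ := hierarchy_two_two h (.inl 1) (.inr 0)
    (pt a (-a - η) (c + b + ξ + η) (c - b + ξ))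
  simp only [shift_pt_inl_zero, shift_pt_inl_one, shift_pt_inr_zero, shift_pt_inr_one,
    pt_inl_zero, pt_inl_one, pt_inr_zero, pt_inr_one, add_sub_cancel_right, sub_add_cancel,
    hPp, hPp', hPm, hFp, hFp', hFm, hFm', e1, e2, e3,
    mul_neg, exp_neg, ← exp_mul_del' h.balanced, ← exp_mul_del, ← exp_mul_gam] at E1 E2 E3 E4
  rw [PsiPlus_two h, PsiMinus_two h]
  simp only [PsiPlus, PsiMinus, PhiPlus, PhiMinus, one_add_one_eq_two]
  have ha := exp_ne_zero a
  have hb := exp_ne_zero b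
  have hη := exp_ne_zero η
  have hγ : gam η d ≠ 0 := exp_ne_zero _
  have hδ : del η d ≠ 0 := exp_ne_zero _
  have h12 := exp_ne_zero (d 1 2 * (η / 2))
  generalize exp (d 1 2 * (η / 2)) = r at *
  generalize gam η d = γ at *
  generalize del η d = δ at *
  generalize exp a = α at *
  generalize exp b = β at *
  generalize exp η = q at *
  generalize exp ξ = x at *
  refine ⟨?_, ?_, ?_, ?_⟩
  · field_simp at E1 ⊢
    linear_combination E1
  · field_simp at E2 ⊢
    linear_combination E2
  · field_simp at E3 ⊢
    linear_combination E3
  · field_simp at E4 ⊢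
    linear_combination E4

/-- The four bilinear relations between `Φ(x)` and `Ψ(x)`, `Ψ(q⁻¹x)`. -/
theorem bilinear_Phi (h : IsReduction η 2 2 d σ) :
    (PhiPlus η σ a b 1 ξ * PhiMinus η σ a b 2 ξ
      + (exp a)⁻¹ * exp b * (gam η d)⁻¹ * del η d * exp ξ
        * (PhiMinus η σ a b 1 ξ * PhiPlus η σ a b 2 ξ)
      = (1 + (exp a)⁻¹ * exp b * exp ξ) * (gam η d)⁻¹
        * (PsiPlus η σ a b 1 (ξ - η) * PsiMinus η σ a b 2 ξ)) ∧
    (exp ξ * (PhiPlus η σ a b 1 ξ * PhiMinus η σ a b 2 ξ)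
      + exp a * (exp b)⁻¹ * (gam η d)⁻¹ * del η d * (PhiMinus η σ a b 1 ξ * PhiPlus η σ a b 2 ξ)
      = (exp a * (exp b)⁻¹ + exp ξ) * del η d
        * (PsiPlus η σ a b 2 (ξ - η) * PsiMinus η σ a b 1 ξ)) ∧
    (exp ξ * (PhiPlus η σ a b 1 ξ * PhiMinus η σ a b 2 ξ)
      + (exp a)⁻¹ * exp b * gam η d * (del η d)⁻¹
        * (PhiMinus η σ a b 1 ξ * PhiPlus η σ a b 2 ξ)
      = ((exp a)⁻¹ * exp b + exp ξ) * (del η d)⁻¹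
        * (PsiMinus η σ a b 1 (ξ - η) * PsiPlus η σ a b 2 ξ)) ∧
    (PhiPlus η σ a b 1 ξ * PhiMinus η σ a b 2 ξ
      + exp a * (exp b)⁻¹ * gam η d * (del η d)⁻¹ * exp ξ
        * (PhiMinus η σ a b 1 ξ * PhiPlus η σ a b 2 ξ)
      = (1 + exp a * (exp b)⁻¹ * exp ξ) * gam η d
        * (PsiMinus η σ a b 2 (ξ - η) * PsiPlus η σ a b 1 ξ)) := by
  set c : ℂ := Real.pi * I - η with hc
  have e1 : exp (c - b + ξ) = -((exp b)⁻¹ * exp ξ * (exp η)⁻¹) := by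
    rw [← exp_neg, ← exp_neg, ← exp_add, ← exp_add, ← exp_pi_mul_I_add]; congr 1; rw [hc]; ring
  have e2 : exp (c + b + ξ + η) = -(exp b * exp ξ) := by
    rw [← exp_add, ← exp_pi_mul_I_add]; congr 1; rw [hc]; ring
  have e3 : exp (-a - η) = (exp a)⁻¹ * (exp η)⁻¹ := by
    rw [← exp_neg, ← exp_neg, ← exp_add]; congr 1
  have hPp : ∀ m n, σ m n (pt (a + η) (-a) (c + b + ξ) (c - b + ξ))
      = exp (d m n * (η / 2)) * rho η σ m n (a + η / 2) b (ξ - η + η / 2) := fun m n =>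
    h.similar_pt m n (η / 2) (by ring) (by ring) (by rw [hc]; ring) (by rw [hc]; ring)
  have hPp' : ∀ m n, σ m n (pt a (-a - η) (c + b + ξ) (c - b + ξ))
      = exp (d m n * (-(η / 2))) * rho η σ m n (a + η / 2) b (ξ + η / 2) := fun m n =>
    h.similar_pt m n (-(η / 2)) (by ring) (by ring) (by rw [hc]; ring) (by rw [hc]; ring)
  have hPm : ∀ m n, σ m n (pt a (-a) (c + b + ξ + η) (c - b + ξ))
      = rho η σ m n a (b + η / 2) (ξ + η / 2) := fun m n =>
    congrArg _ (pt_congr rfl rfl (by rw [hc]; ring) (by rw [hc]; ring))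
  have hPm' : ∀ m n, σ m n (pt a (-a) (c + b + ξ) (c - b + ξ - η))
      = rho η σ m n a (b + η / 2) (ξ - η + η / 2) := fun m n =>
    congrArg _ (pt_congr rfl rfl (by rw [hc]; ring) (by rw [hc]; ring))
  have hFp : ∀ m n, σ m n (pt (a + η) (-a) (c + b + ξ + η) (c - b + ξ))
      = exp (d m n * (η / 2)) * rho η σ m n (a + η / 2) (b + η / 2) ξ := fun m n =>
    h.similar_pt m n (η / 2) (by ring) (by ring) (by rw [hc]; ring) (by rw [hc]; ring)
  have hFp' : ∀ m n, σ m n (pt a (-a - η) (c + b + ξ) (c - b + ξ - η))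
      = exp (d m n * (-(η / 2))) * rho η σ m n (a + η / 2) (b + η / 2) ξ := fun m n =>
    h.similar_pt m n (-(η / 2)) (by ring) (by ring) (by rw [hc]; ring) (by rw [hc]; ring)
  have hFm : ∀ m n, σ m n (pt a (-a) (c + b + ξ) (c - b + ξ))
      = rho η σ m n a b ξ := fun m n => rfl
  -- Now the base points are those of `Ψ⁻(x)` and `Ψ⁺(x)`. The double shifts `T_1T_{-1}` and
  -- `T_2T_{-2}` lead to `Ψ⁺(q⁻¹x)` and `Ψ⁻(q⁻¹x)`, and the single shifts to `Φ⁺(x)` and `Φ⁻(x)`.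
  obtain ⟨-, -, E1, E2⟩ := hierarchy_two_two h (.inl 0) (.inr 0)
    (pt a (-a) (c + b + ξ + η) (c - b + ξ))
  obtain ⟨-, -, E3, E4⟩ := hierarchy_two_two h (.inl 1) (.inr 1)
    (pt a (-a - η) (c + b + ξ) (c - b + ξ))
  simp only [shift_pt_inl_zero, shift_pt_inl_one, shift_pt_inr_zero, shift_pt_inr_one,
    pt_inl_zero, pt_inl_one, pt_inr_zero, pt_inr_one, add_sub_cancel_right, sub_add_cancel,
    hPp, hPp', hPm, hPm', hFp', hFm, hFp, e1, e2, e3,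
    mul_neg, exp_neg, ← exp_mul_del' h.balanced, ← exp_mul_del, ← exp_mul_gam] at E1 E2 E3 E4
  rw [PsiPlus_two h, PsiMinus_two h, PsiPlus_two h, PsiMinus_two h]
  simp only [PsiPlus, PsiMinus, PhiPlus, PhiMinus, one_add_one_eq_two]
  have ha := exp_ne_zero a
  have hb := exp_ne_zero b
  have hη := exp_ne_zero η
  have hγ : gam η d ≠ 0 := exp_ne_zero _
  have hδ : del η d ≠ 0 := exp_ne_zero _
  have h12 := exp_ne_zero (d 1 2 * (η / 2))
  generalize exp (d 1 2 * (η / 2)) = r at *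
  generalize gam η d = γ at *
  generalize del η d = δ at *
  generalize exp a = α at *
  generalize exp b = β at *
  generalize exp η = q at *
  generalize exp ξ = x at *
  refine ⟨?_, ?_, ?_, ?_⟩
  · field_simp at E1 ⊢
    linear_combination E1
  · field_simp at E2 ⊢
    linear_combination E2
  · field_simp at E3 ⊢
    linear_combination E3
  · field_simp at E4 ⊢
    linear_combination E4

end

end QPainleveD5

/-! ### Type D: the q-Painlevé VI equation and its parameters -/

namespace QPainleveD5

open Complex LatticeQUC

section

variable {η : ℂ} {d : ℤ → ℤ → ℂ} {σ : ℤ → ℤ → (Fin 2 ⊕ Fin 2 → ℂ) → ℂ}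

/-- Up to nonzero factors these are differences `t_i - q^k t_j` for the four pairs `(i, j)`, with
`k` equal to 1 or 2; the plus signs come from the minus sign in `t_{-1}`, `t_{-2}`. They are the
constants on the product sides of the bilinear relations. -/
theorem Generic.add_ne_zero {a b ξ : ℂ} (h : Generic η a b ξ) :
    exp a * exp b + exp ξ ≠ 0 ∧ (exp a)⁻¹ * (exp b)⁻¹ + exp η * exp ξ ≠ 0 ∧
      exp a * (exp b)⁻¹ + exp ξ ≠ 0 ∧ (exp a)⁻¹ * exp b + exp ξ ≠ 0 := by
  have key : ∀ u v w : ℂ, exp u ≠ exp (Real.pi * I + v) → exp (u + w) + exp (v + w) ≠ 0 := by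
    intro u v w huv h0
    rw [exp_add, exp_add, ← add_mul] at h0
    apply huv
    rw [exp_pi_mul_I_add]
    exact eq_neg_of_add_eq_zero_left ((mul_eq_zero.1 h0).resolve_right (exp_ne_zero _))
  simp only [← exp_neg, ← exp_add]
  refine ⟨?_, ?_, ?_, ?_⟩
  · convert key a (-b + ξ) b ?_ using 3
    · ring
    · have h' := h 0 1 1
      simp only [point_eq_pt, pt_inl_zero, pt_inr_one] at h'
      convert h' using 2; push_cast; ring
  · convert key (-a) (b + η + ξ) (-b) ?_ using 3
    · ring
    · have h' := h 1 0 2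
      simp only [point_eq_pt, pt_inl_one, pt_inr_zero] at h'
      convert h' using 2; push_cast; ring
  · convert key a (b + ξ) (-b) ?_ using 3
    · ring
    · have h' := h 0 0 1
      simp only [point_eq_pt, pt_inl_zero, pt_inr_zero] at h'
      convert h' using 2; push_cast; ring
  · convert key (-a) (-b + ξ) b ?_ using 3
    · ring
    · have h' := h 1 1 1
      simp only [point_eq_pt, pt_inl_one, pt_inr_one] at h'
      convert h' using 2; push_cast; ring

/-- Half steps in `α`, `β`, `x` whose total number is even stay on the `q`-lattice up to a common
factor, here `q^{-k/2}`. -/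
theorem rho_ne_zero (h : IsReduction η 2 2 d σ) {a b ξ : ℂ}
    (hσ : NonvanishingAlong η σ (point η a b ξ)) (m n : ℤ) (k k' k'' : ℤ) :
    rho η σ m n (a + k * (η / 2)) (b + k' * (η / 2)) (ξ + (k + k' + 2 * k'') * (η / 2)) ≠ 0 := by
  rw [point_eq_pt] at hσ
  rw [rho, point_eq_pt]
  refine hσ.ne_zero_pt h m n k 0 (k + k' + k'') (k + k'') (-(k * (η / 2))) ?_ ?_ ?_ ?_ <;>
    push_cast <;> ring

theorem Phi_Psi_ne_zero (h : IsReduction η 2 2 d σ) {a b ξ : ℂ}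
    (hσ : NonvanishingAlong η σ (point η a b ξ)) (i k : ℤ) :
    PhiPlus η σ a b i (ξ + k * η) ≠ 0 ∧ PhiMinus η σ a b i (ξ + k * η) ≠ 0 ∧
      PsiPlus η σ a b i (ξ + k * η) ≠ 0 ∧ PsiMinus η σ a b i (ξ + k * η) ≠ 0 := by
  refine ⟨?_, ?_, ?_, ?_⟩
  · convert rho_ne_zero h hσ i i 1 1 (k - 1) using 1
    rw [PhiPlus]; push_cast; ring_nf
  · convert rho_ne_zero h hσ i i 0 0 k using 1
    rw [PhiMinus]; push_cast; ring_nf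
  · convert rho_ne_zero h hσ i (i + 1) 1 0 k using 1
    rw [PsiPlus]; push_cast; ring_nf
  · convert rho_ne_zero h hσ i (i + 1) 0 1 k using 1
    rw [PsiMinus]; push_cast; ring_nf

/-- Putting a linear factor over the denominator of `g` or `f` turns its numerator into the two-term
side of a bilinear relation, hence into a monomial in `Φ` or `Ψ`. The quotient of four such
monomials is `f(qx) f(x)` or `g(q⁻¹x) g(x)`. -/
theorem symmetricEquation (h : IsReduction η 2 2 d σ) {a b ξ : ℂ} (hg : Generic η a b ξ)
    (hσ : NonvanishingAlong η σ (point η a b ξ)) :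
    SymmetricEquation (exp η) (exp a) (exp b) (gam η d) (del η d) (exp ξ)
      (f η σ a b ξ) (f η σ a b (ξ + η)) (g η σ a b ξ) (g η σ a b (ξ - η)) := by
  obtain ⟨c1, c2, c3, c4⟩ := hg.add_ne_zero
  obtain ⟨E1, E2, E3, E4⟩ := bilinear_Psi a b ξ h
  obtain ⟨F1, F2, F3, F4⟩ := bilinear_Phi a b ξ h
  have n0 := fun i => Phi_Psi_ne_zero h hσ i 0
  have n1 := fun i => Phi_Psi_ne_zero h hσ i 1
  have n2 := fun i => Phi_Psi_ne_zero h hσ i (-1)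
  simp only [Int.cast_zero, zero_mul, add_zero, Int.cast_one, one_mul, Int.cast_neg, neg_mul,
    ← sub_eq_add_neg] at n0 n1 n2
  obtain ⟨u1, u2, u3, u4⟩ := n0 1
  obtain ⟨v1, v2, v3, v4⟩ := n0 2
  obtain ⟨w1, w2, -, -⟩ := n1 1
  obtain ⟨x1, x2, -, -⟩ := n1 2
  obtain ⟨-, -, y3, y4⟩ := n2 1
  obtain ⟨-, -, z3, z4⟩ := n2 2
  have ha := exp_ne_zero a
  have hb := exp_ne_zero b
  have hγ : gam η d ≠ 0 := exp_ne_zero _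
  have hδ : del η d ≠ 0 := exp_ne_zero _
  simp only [f, g]
  generalize gam η d = γ at *
  generalize del η d = δ at *
  generalize exp a = α at *
  generalize exp b = β at *
  generalize exp η = q at *
  generalize exp ξ = x at *
  have key : ∀ P M c k : ℂ, M ≠ 0 → P / M + c = (P + c * M) / M ∧
      k * (P / M) + c = (k * P + c * M) / M := by
    intro P M c k hM
    constructor <;> field_simp
  have hM := mul_ne_zero u4 v3
  have hM' := mul_ne_zero u2 v1
  have G1 := (key (PsiPlus η σ a b 1 ξ * PsiMinus η σ a b 2 ξ) _ (α⁻¹ * β⁻¹ * γ * δ * x) 1 hM).1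
  have G2 := (key (PsiPlus η σ a b 1 ξ * PsiMinus η σ a b 2 ξ) _ (α * β * γ * δ) x hM).2
  have G3 := (key (PsiPlus η σ a b 1 ξ * PsiMinus η σ a b 2 ξ) _ (α⁻¹ * β⁻¹ * γ⁻¹ * δ⁻¹)
    (q * x) hM).2
  have G4 := (key (PsiPlus η σ a b 1 ξ * PsiMinus η σ a b 2 ξ) _ (α * β * γ⁻¹ * δ⁻¹ * q * x)
    1 hM).1
  have H1 := (key (PhiPlus η σ a b 1 ξ * PhiMinus η σ a b 2 ξ) _ (α⁻¹ * β * γ⁻¹ * δ * x) 1 hM').1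
  have H2 := (key (PhiPlus η σ a b 1 ξ * PhiMinus η σ a b 2 ξ) _ (α * β⁻¹ * γ⁻¹ * δ) x hM').2
  have H3 := (key (PhiPlus η σ a b 1 ξ * PhiMinus η σ a b 2 ξ) _ (α⁻¹ * β * γ * δ⁻¹) x hM').2
  have H4 := (key (PhiPlus η σ a b 1 ξ * PhiMinus η σ a b 2 ξ) _ (α * β⁻¹ * γ * δ⁻¹ * x) 1 hM').1
  rw [E1] at G1
  rw [E2] at G2
  rw [E3] at G3
  rw [E4] at G4
  rw [F1] at H1
  rw [F2] at H2
  rw [F3] at H3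
  rw [F4] at H4
  -- The constants of the numerators are those of the denominators times `(αβ)^{∓1}`, respectively
  -- `(β/α)^{±1}`, so they cancel in each equation.
  have k1 : 1 + α⁻¹ * β⁻¹ * x = (α * β)⁻¹ * (α * β + x) := by field_simp
  have k4 : 1 + α * β * q * x = α * β * (α⁻¹ * β⁻¹ + q * x) := by field_simp
  have l1 : 1 + α⁻¹ * β * x = (α⁻¹ * β) * (α * β⁻¹ + x) := by field_simp
  have l4 : 1 + α * β⁻¹ * x = (α * β⁻¹) * (α⁻¹ * β + x) := by field_simp
  rw [k1] at G1
  rw [k4] at G4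
  rw [l1] at H1
  rw [l4] at H4
  generalize α * β + x = r1 at *
  generalize α⁻¹ * β⁻¹ + q * x = r2 at *
  generalize α * β⁻¹ + x = r3 at *
  generalize α⁻¹ * β + x = r4 at *
  refine ⟨?_, ?_, ?_, ?_⟩
  · rw [G2, G3]; positivity
  · rw [H2, H3]; positivity
  · rw [G1, G2, G3, G4]; field_simp
  · rw [H1, H2, H3, H4]; field_simp

end

theorem paramA_paramB_isParam {q α β γ δ : ℂ} (hq : q ≠ 0) (hα : α ≠ 0) (hβ : β ≠ 0)
    (hγ : γ ≠ 0) (hδ : δ ≠ 0) :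
    IsParam (q ^ 2) (paramA α β γ δ) (paramB q α β γ δ) := by
  refine ⟨?_, ?_, ?_⟩
  · intro i; fin_cases i <;> simp [paramA, *]
  · intro i; fin_cases i <;> simp [paramB, *]
  · simp [paramA, paramB]; field_simp

/-- The symmetric form implies the Jimbo–Sakai form. -/
theorem SymmetricEquation.equation {q α β γ δ x f fUp g gDown : ℂ}
    (h : SymmetricEquation q α β γ δ x f fUp g gDown) (hq : q ≠ 0) (hα : α ≠ 0) (hβ : β ≠ 0)
    (hγ : γ ≠ 0) (hδ : δ ≠ 0) (hx : x ≠ 0) :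
    Equation (paramA α β γ δ) (paramB q α β γ δ) (x ^ 2) (x * f) (x * q * fUp)
      (x / q * gDown) (x * g) := by
  obtain ⟨hg, hf, eq_f, eq_g⟩ := h
  have b2 : x * g - paramB q α β γ δ 2 = x * g + α * β * γ * δ := by simp [paramB]
  have b3 : x * g - paramB q α β γ δ 3
      = q⁻¹ * (q * x * g + α⁻¹ * β⁻¹ * γ⁻¹ * δ⁻¹) := by
    simp [paramB]; field_simp
  have a2 : x * f - paramA α β γ δ 2 = x * f + α * β⁻¹ * γ⁻¹ * δ := by simp [paramA]
  have a3 : x * f - paramA α β γ δ 3 = x * f + α⁻¹ * β * γ * δ⁻¹ := by simp [paramA]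
  have b0 : x * g - x ^ 2 * paramB q α β γ δ 0 = x * (g + α⁻¹ * β⁻¹ * γ * δ * x) := by
    simp [paramB]; ring
  have b1 : x * g - x ^ 2 * paramB q α β γ δ 1 = x * (g + α * β * γ⁻¹ * δ⁻¹ * q * x) := by
    simp [paramB]; ring
  have a0 : x * f - x ^ 2 * paramA α β γ δ 0 = x * (f + α⁻¹ * β * γ⁻¹ * δ * x) := by
    simp [paramA]; ring
  have a1 : x * f - x ^ 2 * paramA α β γ δ 1 = x * (f + α * β⁻¹ * γ * δ⁻¹ * x) := by
    simp [paramA]; ring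
  have a23 : paramA α β γ δ 2 * paramA α β γ δ 3 = 1 := by simp [paramA]; field_simp
  have b23 : paramB q α β γ δ 2 * paramB q α β γ δ 3 = q⁻¹ := by simp [paramB]; field_simp
  obtain ⟨hg1, hg2⟩ := mul_ne_zero_iff.1 hg
  obtain ⟨hf1, hf2⟩ := mul_ne_zero_iff.1 hf
  refine ⟨?_, ?_, ?_, ?_⟩
  · rw [b2, b3]; positivity
  · rw [a2, a3]; exact hf
  · rw [b0, b1, b2, b3, a23, div_one]
    rw [show x * f * (x * q * fUp) = x ^ 2 * q * (fUp * f) by ring, eq_f]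
    generalize x * g + α * β * γ * δ = D at *
    generalize q * x * g + α⁻¹ * β⁻¹ * γ⁻¹ * δ⁻¹ = D' at *
    field_simp
  · rw [a0, a1, a2, a3, b23]
    rw [show x / q * gDown * (x * g) / q⁻¹ = x ^ 2 * (gDown * g) by field_simp, eq_g]
    ring

/-- All parameters of the q-Painlevé VI equation arise, up to rescaling. -/
theorem exists_exponents {η : ℂ} (hη : η ≠ 0) {a' b' : Fin 4 → ℂ}
    (h : IsParam (exp η ^ 2) a' b') :
    ∃ (d : ℤ → ℤ → ℂ) (a b l m k : ℂ), Balanced d ∧ BiPeriodic 2 2 d ∧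
      l ≠ 0 ∧ m ≠ 0 ∧ k ≠ 0 ∧
      a' = rescale l k (paramA (exp a) (exp b) (gam η d) (del η d)) ∧
      b' = rescale m k (paramB (exp η) (exp a) (exp b) (gam η d) (del η d)) := by
  obtain ⟨ha, hb, hr⟩ := h
  choose A hA using fun i => (⟨log (a' i), exp_log (ha i)⟩ : ∃ z, exp z = a' i)
  choose B hB using fun i => (⟨log (b' i), exp_log (hb i)⟩ : ∃ z, exp z = b' i)
  -- The logarithm of `b'_1` is dictated by the other seven, so that the relation between the
  -- parameters holds for the logarithms and not only modulo `2πi`.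
  set B0 : ℂ := 2 * η + A 0 + A 1 - A 2 - A 3 - B 1 + B 2 + B 3 with hB0
  have hB0' : exp B0 = b' 0 := by
    have e : exp B0 = exp η ^ 2 * (a' 0 * a' 1 / (a' 2 * a' 3)) * (b' 2 * b' 3) / b' 1 := by
      rw [hB0, sq]
      simp only [exp_add, exp_sub, hA, hB, two_mul]
      field_simp [ha 2, ha 3, hb 1]
    rw [e, ← hr]
    field_simp [hb 1, hb 2, hb 3]
  -- Half logarithms of `a_1/a_2`, `a_3/a_4`, `q b_1/b_2`, `b_3/(q b_4)`, which rescaling does not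
  -- change. In terms of the logarithms of `α, β, γ, δ` they are four linear forms with coefficients
  -- `±1`; the sign matrix has orthogonal rows, so a quarter of its transpose inverts it.
  set L1 := (A 0 - A 1) / 2
  set L2 := (A 2 - A 3) / 2
  set L3 := (B0 - B 1 + η) / 2
  set L4 := (B 2 - B 3 - η) / 2
  set a : ℂ := (-L1 + L2 - L3 + L4) / 4 with h_a
  set b : ℂ := (L1 - L2 - L3 + L4) / 4 with h_b
  set c : ℂ := (-L1 - L2 + L3 + L4) / 4 with h_c
  set e : ℂ := (L1 + L2 + L3 + L4) / 4 with h_e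
  set d : ℤ → ℤ → ℂ := fun m n =>
    (if Even m then 2 * e / η else 0) + (if Even n then -(2 * c / η) else 0) with hd
  have hγ : gam η d = exp c := by
    have e2 : Even (2 : ℤ) := even_two
    have e1 : ¬ Even (1 : ℤ) := by decide
    simp only [gam, hd, e1, e2, if_true, if_false]
    congr 1; field_simp; ring
  have hδ : del η d = exp e := by
    have e2 : Even (2 : ℤ) := even_two
    have e1 : ¬ Even (1 : ℤ) := by decide
    simp only [del, hd, e1, e2, if_true, if_false]
    congr 1; field_simp; ring
  -- The scale factors are read off from the products `a_3a_4 = l²`, `b_3b_4 = m²/q`, `a_1a_2 =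
  -- l²/k²`; the product `b_1b_2` then comes out right by the choice of `B0`. The signs absorb those
  -- in `paramA` and `paramB`.
  refine ⟨d, a, b, -exp ((A 2 + A 3) / 2), -exp ((B 2 + B 3 + η) / 2),
    exp ((A 2 + A 3 - A 0 - A 1) / 2), ?_, ?_, neg_ne_zero.2 (exp_ne_zero _),
    neg_ne_zero.2 (exp_ne_zero _), exp_ne_zero _, ?_, ?_⟩
  · intro m n; simp only [hd]; ring
  · intro m n; simp [hd]
  · rw [hγ, hδ]
    funext i
    fin_cases i <;>
    simp only [rescale, paramA, ← hA, ← exp_neg, ← exp_add, neg_mul_neg, neg_div, ← exp_sub,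
      Fin.zero_eta, Fin.mk_one, Fin.reduceFinMk, Matrix.cons_val] <;> congr 1 <;> grind
  · rw [hγ, hδ]
    funext i
    fin_cases i <;>
    simp only [rescale, paramB, ← hB0', ← hB, ← exp_neg, ← exp_add, neg_mul_neg, neg_div,
      ← exp_sub, Fin.zero_eta, Fin.mk_one, Fin.reduceFinMk, Matrix.cons_val] <;> congr 1 <;> grind

end QPainleveD5

/-! ### Type A: periodic sequences and cyclic linear systems -/

namespace QPainleveA

open Complex LatticeQUC

/-! ### Periodic sequences on `ℤ` -/

theorem prod_range_two_mul (h : ℕ → ℂ) (n : ℕ) :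
    ∏ i ∈ Finset.range (2 * n), h i = ∏ j ∈ Finset.range n, h (2 * j) * h (2 * j + 1) := by
  induction n with
  | zero => simp
  | succ n ih =>
    rw [Finset.prod_range_succ, ← ih, show 2 * (n + 1) = 2 * n + 1 + 1 by ring,
      Finset.prod_range_succ, Finset.prod_range_succ, mul_assoc]

/-- The product of a nowhere zero periodic sequence over a period. -/
theorem prod_range_add_eq {N : ℕ} {h : ℤ → ℂ} (hp : ∀ i, h (i + N) = h i) (h0 : ∀ i, h i ≠ 0)
    (i : ℤ) : ∏ l ∈ Finset.range N, h (i + l) = ∏ l ∈ Finset.range N, h l := by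
  have step : ∀ i : ℤ,
      ∏ l ∈ Finset.range N, h (i + 1 + l) = ∏ l ∈ Finset.range N, h (i + l) := by
    intro i
    apply mul_right_cancel₀ (h0 i)
    have h1 := Finset.prod_range_succ (fun l : ℕ => h (i + l)) N
    have h2 := Finset.prod_range_succ' (fun l : ℕ => h (i + l)) N
    rw [h1, hp] at h2
    rw [h2]
    simp [add_assoc, add_comm (1 : ℤ)]
  induction i using Int.induction_on with
  | zero => simp
  | succ i ih => rw [step, ih]
  | pred i ih => rw [← ih, ← step, sub_add_cancel]

theorem prod_range_div_eq_one {n : ℕ} {F : ℕ → ℂ} (h0 : ∀ i, F i ≠ 0) (hn : F n = F 0) :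
    ∏ j ∈ Finset.range n, F (j + 1) / F j = 1 := by
  have : ∀ k, ∏ j ∈ Finset.range k, F (j + 1) / F j = F k / F 0 := by
    intro k
    induction k with
    | zero => simp [h0]
    | succ k ih => rw [Finset.prod_range_succ, ih]; field_simp [h0]
  rw [this, hn, div_self (h0 0)]

/-- Solution of a cyclic system of linear equations `X_i - a_i f_i X_{i+1} = c`. -/
theorem poly_eq_of_cyclic {a f X : ℤ → ℂ} {c : ℂ} (h : ∀ i, X i - a i * f i * X (i + 1) = c)
    (N : ℕ) (i : ℤ) :
    X i = c * poly N a f i + (∏ l ∈ Finset.range N, a (i + l) * f (i + l)) * X (i + N) := by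
  induction N with
  | zero => simp [poly]
  | succ N ih =>
    rw [poly, Finset.sum_range_succ, ← poly, Finset.prod_range_succ]
    have h1 := h (i + N)
    push_cast
    rw [← add_assoc]
    linear_combination ih + (∏ l ∈ Finset.range N, a (i + l) * f (i + l)) * h1

/-- Take partial sums up to the residue of `i` modulo `M`; the vanishing sum over a period makes the
step from residue `M - 1` to residue `0` correct. -/
theorem exists_periodic_antidifference {M : ℕ} (hM : 0 < M) {h : ℤ → ℂ} (hp : ∀ i, h (i + M) = h i)
    (hs : ∑ k ∈ Finset.range M, h k = 0) :
    ∃ H : ℤ → ℂ, (∀ i, H (i + M) = H i) ∧ ∀ i, H (i + 1) - H i = h i := by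
  have hM' : (M : ℤ) ≠ 0 := by exact_mod_cast hM.ne'
  have hper : ∀ i, h (i % M) = h i := by
    intro i
    have : Function.Periodic h (M : ℤ) := hp
    rw [Int.emod_def, mul_comm]
    exact this.sub_int_mul_eq (i / M)
  refine ⟨fun i => ∑ k ∈ Finset.range (i % M).toNat, h k, fun i => by simp, fun i => ?_⟩
  have h0 := Int.emod_nonneg i hM'
  have h1 := Int.emod_lt_of_pos i (by exact_mod_cast hM : (0 : ℤ) < M)
  obtain ⟨k, hk⟩ := Int.eq_ofNat_of_zero_le h0
  simp only
  rw [Int.add_emod, hk]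
  rw [hk] at h1
  rw [← hper, hk]
  by_cases hkM : k + 1 = M
  · have : ((k : ℤ) + 1 % M) % M = 0 := by
      rw [Int.add_emod_emod, ← hkM]; simp
    rw [this]
    rw [← hkM, Finset.sum_range_succ] at hs
    simp only [Int.toNat_zero, Finset.range_zero, Finset.sum_empty, Int.toNat_natCast]
    linear_combination -hs
  · have : ((k : ℤ) + 1 % M) % M = (k + 1 : ℕ) := by
      rw [Int.add_emod_emod]
      push_cast
      exact Int.emod_eq_of_lt (by omega) (by omega)
    rw [this]
    simp only [Int.toNat_natCast]
    rw [Finset.sum_range_succ, add_sub_cancel_left]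

end QPainleveA

/-! ### Type A: three-term bilinear relations between the `τ_i` -/

namespace QPainleveA

open Complex LatticeQUC

/-- Coordinates in which the roles of `t_{-1}` and `t_{-2}` are exchanged for odd `n`. -/
def altPt (n : ℤ) (x₁ x₂ y z : ℂ) : Fin 2 ⊕ Fin 2 → ℂ :=
  if Even n then pt x₁ x₂ y z else pt x₁ x₂ z y

/-- The index of the third of the coordinates `altPt n`. -/
def altIndex (n : ℤ) : Fin 2 ⊕ Fin 2 := if Even n then .inr 0 else .inr 1

section

variable (η : ℂ) (n : ℤ) (x₁ x₂ y z : ℂ)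

theorem altPt_inl_zero : altPt n x₁ x₂ y z (.inl 0) = x₁ := by
  unfold altPt; split_ifs <;> rfl

theorem altPt_inl_one : altPt n x₁ x₂ y z (.inl 1) = x₂ := by
  unfold altPt; split_ifs <;> rfl

theorem altPt_altIndex : altPt n x₁ x₂ y z (altIndex n) = y := by
  unfold altPt altIndex; split_ifs <;> rfl

theorem shift_altPt_inl_zero :
    shift η (.inl 0) (altPt n x₁ x₂ y z) = altPt n (x₁ + η) x₂ y z := by
  unfold altPt; split_ifs <;> simp

theorem shift_altPt_inl_one :
    shift η (.inl 1) (altPt n x₁ x₂ y z) = altPt n x₁ (x₂ + η) y z := by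
  unfold altPt; split_ifs <;> simp

theorem shift_altPt_altIndex :
    shift η (altIndex n) (altPt n x₁ x₂ y z) = altPt n x₁ x₂ (y - η) z := by
  unfold altPt altIndex; split_ifs <;> simp

/-- The common part `log (-q⁻¹x)` of the logarithms of `t_{-1}` and `t_{-2}`. -/
noncomputable def logJ (ξ : ℂ) : ℂ := Real.pi * I - η + ξ

/-- The offset `∓ η / 2` that depends on the parity of the index of `τ`. -/
noncomputable def offset (m : ℤ) : ℂ := if Even m then -(η / 2) else η / 2

variable (a ξ : ℂ) (m : ℤ)

theorem point_eq_altPt : point η a ξ m n =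
    altPt n (a + n * η / 2) (-(a + n * η / 2)) (logJ η ξ) (logJ η ξ + offset η m) := by
  unfold point altPt logJ offset pt; split_ifs <;> rfl

theorem point_succ_eq_altPt : point η a ξ m (n + 1) =
    altPt n (a + n * η / 2 + η / 2) (-(a + n * η / 2) - η / 2)
      (logJ η ξ + offset η m) (logJ η ξ) := by
  rw [point_eq_altPt]
  unfold altPt
  by_cases h : Even n
  · rw [if_neg (by simpa [Int.even_add_one] using h), if_pos h]
    exact pt_congr (by push_cast; ring) (by push_cast; ring) rfl rfl
  · rw [if_pos (by simpa [Int.even_add_one] using h), if_neg h]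
    exact pt_congr (by push_cast; ring) (by push_cast; ring) rfl rfl

theorem point_pred_eq_altPt : point η a ξ m (n - 1) =
    altPt n (a + n * η / 2 - η / 2) (-(a + n * η / 2) + η / 2)
      (logJ η ξ + offset η m) (logJ η ξ) := by
  rw [point_eq_altPt]
  unfold altPt
  by_cases h : Even n
  · rw [if_neg (by simpa [Int.even_sub_one] using h), if_pos h]
    exact pt_congr (by push_cast; ring) (by push_cast; ring) rfl rfl
  · rw [if_pos (by simpa [Int.even_sub_one] using h), if_neg h]
    exact pt_congr (by push_cast; ring) (by push_cast; ring) rfl rfl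

end

section

variable {η : ℂ} {N₁ N₂ : ℤ} {d : ℤ → ℤ → ℂ} {σ : ℤ → ℤ → (Fin 2 ⊕ Fin 2 → ℂ) → ℂ}

theorem similar_altPt (h : IsReduction η N₁ N₂ d σ) (m m' n : ℤ) {x₁ x₂ y z x₁' x₂' y' z' : ℂ}
    (s : ℂ) (h₁ : x₁' = x₁ + s) (h₂ : x₂' = x₂ + s) (h₃ : y' = y + s) (h₄ : z' = z + s) :
    σ m m' (altPt n x₁' x₂' y' z') = exp (d m m' * s) * σ m m' (altPt n x₁ x₂ y z) := by
  unfold altPt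
  split_ifs
  · exact h.similar_pt m m' s h₁ h₂ h₃ h₄
  · exact h.similar_pt m m' s h₁ h₂ h₄ h₃

/-- For odd `n` the coordinates of `t_1`, `t_2` are off the lattice by half a step. Exchanging
`t_{-1}` and `t_{-2}`, which themselves differ by half a step, and removing a common `q^{1/2}`
brings the point back; this is why their roles alternate. -/
theorem altPt_ne_zero (h : IsReduction η N₁ N₂ d σ) {a ξ : ℂ}
    (hσ : NonvanishingAlong η σ (point η a ξ 0 0)) (m m' n k₁ k₂ l₁ l₂ : ℤ) {x₁ x₂ y z : ℂ}
    (h₁ : x₁ = a + n * η / 2 + k₁ * η) (h₂ : x₂ = -(a + n * η / 2) + k₂ * η)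
    (h₃ : y = logJ η ξ + l₁ * η) (h₄ : z = logJ η ξ - η / 2 + l₂ * η) :
    σ m m' (altPt n x₁ x₂ y z) ≠ 0 := by
  have h0 : point η a ξ 0 0 = pt a (-a) (logJ η ξ) (logJ η ξ - η / 2) := by
    rw [point_eq_altPt, altPt, if_pos Even.zero, offset, if_pos Even.zero]
    exact pt_congr (by simp) (by simp) rfl (by ring)
  rw [h0] at hσ
  unfold altPt
  split_ifs with hn
  · obtain ⟨r, rfl⟩ := hn
    refine hσ.ne_zero_pt h m m' (r + k₁) (k₂ - r) l₁ l₂ 0 ?_ ?_ ?_ ?_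
    · rw [h₁]; push_cast; ring
    · rw [h₂]; push_cast; ring
    · rw [h₃]; ring
    · rw [h₄]; ring
  · obtain ⟨r, rfl⟩ := Int.not_even_iff_odd.1 hn
    refine hσ.ne_zero_pt h m m' (r + k₁) (k₂ - r - 1) (l₂ - 1) l₁ (η / 2) ?_ ?_ ?_ ?_
    · rw [h₁]; push_cast; ring
    · rw [h₂]; push_cast; ring
    · rw [h₄]; push_cast; ring
    · rw [h₃]; ring

theorem tau_ne_zero (h : IsReduction η N₁ N₂ d σ) {a ξ : ℂ}
    (hσ : NonvanishingAlong η σ (point η a ξ 0 0)) (m n : ℤ) : tau η a ξ σ m n ≠ 0 := by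
  rw [tau, point_eq_altPt]
  unfold offset
  split_ifs
  · exact altPt_ne_zero h hσ _ _ n 0 0 0 0 (by simp) (by simp) (by simp) (by simp; ring)
  · exact altPt_ne_zero h hσ _ _ n 0 0 0 1 (by simp) (by simp) (by simp) (by simp; ring)

theorem tau_two_mul (η a ξ : ℂ) (σ : ℤ → ℤ → (Fin 2 ⊕ Fin 2 → ℂ) → ℂ) (j n : ℤ) :
    tau η a ξ σ (2 * j) n = σ (-j) j (point η a ξ (2 * j) n) := by
  rw [tau, Int.mul_ediv_cancel_left _ two_ne_zero, Int.mul_emod_right, add_zero]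

theorem tau_two_mul_add_one (η a ξ : ℂ) (σ : ℤ → ℤ → (Fin 2 ⊕ Fin 2 → ℂ) → ℂ) (j n : ℤ) :
    tau η a ξ σ (2 * j + 1) n = σ (-j) (j + 1) (point η a ξ (2 * j + 1) n) := by
  rw [tau, show (2 * j + 1) / 2 = j by omega, show (2 * j + 1) % 2 = 1 by omega]

theorem exp_logJ (η ξ : ℂ) : exp (logJ η ξ) = -(exp ξ * (exp η)⁻¹) := by
  rw [← exp_neg, ← exp_add, ← QPainleveD5.exp_pi_mul_I_add, logJ]; congr 1; ring

variable (σ) in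
/-- The values that enter the bilinear relations, in terms of a common base point. -/
theorem altPt_values (h : IsReduction η N₁ N₂ d σ) (a ξ : ℂ) (n m m' : ℤ) {i i' : ℤ}
    (hi : Even i) (hi' : ¬ Even i') :
    σ m m' (altPt n (a + n * η / 2) (-(a + n * η / 2)) (logJ η ξ) (logJ η ξ - η / 2))
      = σ m m' (point η a ξ i n) ∧
    σ m m' (altPt n (a + n * η / 2 - η) (-(a + n * η / 2) - η) (logJ η ξ - η) (logJ η ξ - η / 2))
      = exp (d m m' * (-η)) * σ m m' (point η a ξ i' n) ∧
    σ m m' (altPt n (a + n * η / 2) (-(a + n * η / 2) - η) (logJ η ξ - η) (logJ η ξ - η / 2))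
      = exp (d m m' * (-(η / 2))) * σ m m' (point η a ξ i (n + 1)) ∧
    σ m m' (altPt n (a + n * η / 2 - η) (-(a + n * η / 2)) (logJ η ξ - η) (logJ η ξ - η / 2))
      = exp (d m m' * (-(η / 2))) * σ m m' (point η a ξ i (n - 1)) ∧
    σ m m' (altPt n (a + n * η / 2) (-(a + n * η / 2) - η) (logJ η ξ) (logJ η ξ - η / 2))
      = exp (d m m' * (-(η / 2))) * σ m m' (point η a ξ i' (n + 1)) ∧
    σ m m' (altPt n (a + n * η / 2 - η) (-(a + n * η / 2)) (logJ η ξ) (logJ η ξ - η / 2))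
      = exp (d m m' * (-(η / 2))) * σ m m' (point η a ξ i' (n - 1)) := by
  have o : offset η i = -(η / 2) := if_pos hi
  have o' : offset η i' = η / 2 := if_neg hi'
  refine ⟨?_, ?_, ?_, ?_, ?_, ?_⟩
  · rw [point_eq_altPt, o, sub_eq_add_neg]
  all_goals
    first | rw [point_succ_eq_altPt] | rw [point_pred_eq_altPt] | rw [point_eq_altPt]
    simp only [o, o']
    refine similar_altPt h _ _ n _ ?_ ?_ ?_ ?_ <;> ring

variable {a ξ : ℂ}

/-- Eliminate `σ_{-j+1,j}` using the shifts `T_1`, `T_2` and the shift of the alternating variable.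
The three ways to split these into a pair and a single shift give the arguments `(n, n)`, `(n+1,
n-1)`, `(n-1, n+1)` for `τ_{2j}` and `τ_{2j+1}`. -/
theorem bilinear_tau_two_mul (h : IsReduction η N₁ N₂ d σ)
    (hσ : NonvanishingAlong η σ (point η a ξ 0 0)) (j n : ℤ) {α x : ℂ}
    (hα : exp (a + n * η / 2) = α) (hx : exp ξ = x) :
    (1 + x / α) * (tau η a ξ σ (2 * j) (n + 1) * tau η a ξ σ (2 * j + 1) (n - 1))
      - (1 + α * x) * (tau η a ξ σ (2 * j) (n - 1) * tau η a ξ σ (2 * j + 1) (n + 1))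
      = -(α - α⁻¹) * x * exp (η * (d (-j) j - d (-j) (j + 1)) / 2)
        * (tau η a ξ σ (2 * j) n * tau η a ξ σ (2 * j + 1) n) := by
  have hi : Even (2 * j) := even_two_mul j
  have hi' : ¬ Even (2 * j + 1) := by simp
  have E := h.hierarchy.cyclic_succ_right (-j) j (.inl 0) (.inl 1) (altIndex n)
    (altPt n (a + n * η / 2 - η) (-(a + n * η / 2) - η) (logJ η ξ) (logJ η ξ - η / 2))
    (altPt_ne_zero h hσ _ _ n (-1) (-1) 0 0 (by simp; ring) (by simp; ring) (by simp) (by simp))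
  obtain ⟨v1, -, v3, v4, -, -⟩ := altPt_values σ h a ξ n (-j) j hi hi'
  obtain ⟨-, w2, -, -, w5, w6⟩ := altPt_values σ h a ξ n (-j) (j + 1) hi hi'
  simp only [shift_altPt_inl_zero, shift_altPt_inl_one, shift_altPt_altIndex, altPt_inl_zero,
    altPt_inl_one, altPt_altIndex, sub_add_cancel, v1, v3, v4, w2, w5, w6, exp_logJ, hx,
    ← tau_two_mul, ← tau_two_mul_add_one] at E
  have e1 : exp (a + n * η / 2 - η) = α * (exp η)⁻¹ := by rw [exp_sub, hα]; rfl
  have e2 : exp (-(a + n * η / 2) - η) = α⁻¹ * (exp η)⁻¹ := by rw [exp_sub, exp_neg, hα]; rfl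
  -- The `(n, n)` term carries a full step of scaling on one factor, the other two terms a half step
  -- on each factor. The discrepancy is the power of `q` in the conclusion.
  have e3 : exp (d (-j) (j + 1) * (-η)) = exp (d (-j) j * (-(η / 2)))
      * exp (d (-j) (j + 1) * (-(η / 2))) * exp (η * (d (-j) j - d (-j) (j + 1)) / 2) := by
    rw [← exp_add, ← exp_add]; congr 1; ring
  rw [e1, e2, e3] at E
  have hα0 : α ≠ 0 := hα ▸ exp_ne_zero _
  have r1 := exp_ne_zero (d (-j) j * (-(η / 2)))
  have r2 := exp_ne_zero (d (-j) (j + 1) * (-(η / 2)))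
  have r3 := exp_ne_zero η
  generalize exp (d (-j) j * (-(η / 2))) = s1 at *
  generalize exp (d (-j) (j + 1) * (-(η / 2))) = s2 at *
  generalize exp η = q at *
  generalize exp (η * (d (-j) j - d (-j) (j + 1)) / 2) = e at *
  clear v1 v3 v4 w2 w5 w6 e1 e2 e3
  field_simp at E ⊢
  refine mul_left_cancel₀ (mul_ne_zero r1 r2) ?_
  linear_combination -E

/-- The same with `σ_{-j-1,j+2}` eliminated, which leaves `σ_{-j-1,j+1}` and `σ_{-j,j+1}`, that is,
`τ_{2j+2}` and `τ_{2j+1}`. -/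
theorem bilinear_tau_two_mul_add_one (h : IsReduction η N₁ N₂ d σ)
    (hσ : NonvanishingAlong η σ (point η a ξ 0 0)) (j n : ℤ) {α x : ℂ}
    (hα : exp (a + n * η / 2) = α) (hx : exp ξ = x) :
    (x + α⁻¹) * (tau η a ξ σ (2 * j + 1) (n + 1) * tau η a ξ σ (2 * j + 2) (n - 1))
      - (x + α) * (tau η a ξ σ (2 * j + 1) (n - 1) * tau η a ξ σ (2 * j + 2) (n + 1))
      = -(α - α⁻¹) * exp (η * (d (-(j + 1)) (j + 1) - d (-j) (j + 1)) / 2)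
        * (tau η a ξ σ (2 * j + 1) n * tau η a ξ σ (2 * j + 2) n) := by
  have hi : Even (2 * (j + 1)) := even_two_mul _
  have hi' : ¬ Even (2 * j + 1) := by simp
  have hj : -(j + 1) + 1 = -j := by ring
  have E := h.hierarchy.cyclic_succ_left (-(j + 1)) (j + 1) (.inl 0) (.inl 1) (altIndex n)
    (altPt n (a + n * η / 2 - η) (-(a + n * η / 2) - η) (logJ η ξ) (logJ η ξ - η / 2))
    (altPt_ne_zero h hσ _ _ n (-1) (-1) 0 0 (by simp; ring) (by simp; ring) (by simp) (by simp))
  obtain ⟨v1, -, v3, v4, -, -⟩ := altPt_values σ h a ξ n (-(j + 1)) (j + 1) hi hi'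
  obtain ⟨-, w2, -, -, w5, w6⟩ := altPt_values σ h a ξ n (-j) (j + 1) hi hi'
  simp only [hj, shift_altPt_inl_zero, shift_altPt_inl_one, shift_altPt_altIndex, altPt_inl_zero,
    altPt_inl_one, altPt_altIndex, sub_add_cancel, v1, v3, v4, w2, w5, w6, exp_logJ, hx,
    ← tau_two_mul, ← tau_two_mul_add_one] at E
  rw [show 2 * (j + 1) = 2 * j + 2 by ring] at E
  have e1 : exp (a + n * η / 2 - η) = α * (exp η)⁻¹ := by rw [exp_sub, hα]; rfl
  have e2 : exp (-(a + n * η / 2) - η) = α⁻¹ * (exp η)⁻¹ := by rw [exp_sub, exp_neg, hα]; rfl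
  have e3 : exp (d (-j) (j + 1) * (-η)) = exp (d (-(j + 1)) (j + 1) * (-(η / 2)))
      * exp (d (-j) (j + 1) * (-(η / 2)))
      * exp (η * (d (-(j + 1)) (j + 1) - d (-j) (j + 1)) / 2) := by
    rw [← exp_add, ← exp_add]; congr 1; ring
  rw [e1, e2, e3] at E
  have hα0 : α ≠ 0 := hα ▸ exp_ne_zero _
  have r1 := exp_ne_zero (d (-(j + 1)) (j + 1) * (-(η / 2)))
  have r2 := exp_ne_zero (d (-j) (j + 1) * (-(η / 2)))
  have r3 := exp_ne_zero η
  generalize exp (d (-(j + 1)) (j + 1) * (-(η / 2))) = s1 at *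
  generalize exp (d (-j) (j + 1) * (-(η / 2))) = s2 at *
  generalize exp η = q at *
  generalize exp (η * (d (-(j + 1)) (j + 1) - d (-j) (j + 1)) / 2) = e at *
  clear v1 v3 v4 w2 w5 w6 e1 e2 e3
  field_simp at E ⊢
  refine mul_left_cancel₀ (mul_ne_zero r1 r2) ?_
  linear_combination E

end

end QPainleveA

/-! ### Type A: parameters, the polynomials `Q_i`, and the evolution -/

namespace QPainleveA

open Complex LatticeQUC

/-- The factors `q^{(D_i - D_{i+1})/2}` (`i` even), `q^{(D_{i+1} - D_i)/2}` (`i` odd), where `D_i`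
is the exponent of `τ_i`. -/
noncomputable def gauge (η : ℂ) (d : ℤ → ℤ → ℂ) (i : ℤ) : ℂ :=
  if Even i then exp (η * (d (-(i / 2)) (i / 2) - d (-(i / 2)) (i / 2 + 1)) / 2)
  else exp (η * (d (-(i / 2 + 1)) (i / 2 + 1) - d (-(i / 2)) (i / 2 + 1)) / 2)

theorem gauge_two_mul (η : ℂ) (d : ℤ → ℤ → ℂ) (j : ℤ) :
    gauge η d (2 * j) = exp (η * (d (-j) j - d (-j) (j + 1)) / 2) := by
  rw [gauge, if_pos (even_two_mul j), Int.mul_ediv_cancel_left _ two_ne_zero]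

theorem gauge_two_mul_add_one (η : ℂ) (d : ℤ → ℤ → ℂ) (j : ℤ) :
    gauge η d (2 * j + 1) = exp (η * (d (-(j + 1)) (j + 1) - d (-j) (j + 1)) / 2) := by
  rw [gauge, if_neg (by simp), show (2 * j + 1) / 2 = j by omega]

theorem gauge_ne_zero (η : ℂ) (d : ℤ → ℤ → ℂ) (i : ℤ) : gauge η d i ≠ 0 := by
  unfold gauge; split_ifs <;> exact exp_ne_zero _

theorem param_two_mul (η ξ : ℂ) (d : ℤ → ℤ → ℂ) (j : ℤ) :
    param η ξ d (2 * j)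
      = exp (η / 4) * (exp ξ)⁻¹ * (gauge η d (2 * j + 1) / gauge η d (2 * j)) := by
  rw [param, if_pos (even_two_mul j), Int.mul_ediv_cancel_left _ two_ne_zero, gauge_two_mul,
    gauge_two_mul_add_one, ← exp_neg, ← exp_sub, ← exp_add, ← exp_add,
    show -(j + 1) = -j - 1 by ring]
  congr 1; ring

theorem param_two_mul_add_one (η ξ : ℂ) (d : ℤ → ℤ → ℂ) (j : ℤ) :
    param η ξ d (2 * j + 1)
      = exp (η / 4) * exp ξ * (gauge η d (2 * j + 2) / gauge η d (2 * j + 1)) := by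
  rw [param, if_neg (by simp), show (2 * j + 1) / 2 = j by omega,
    show 2 * j + 2 = 2 * (j + 1) by ring, gauge_two_mul, gauge_two_mul_add_one, ← exp_sub,
    ← exp_add, ← exp_add, show -(j + 1) = -j - 1 by ring, show j + 1 + 1 = j + 2 by ring]
  congr 1; ring

/-- In two consecutive parameters `x` and the middle gauge factor cancel. The ratio that remains
telescopes over a period, which fixes the product of all parameters; the same ratio also absorbs the
gauge factors in the evolution equation. -/
theorem param_mul_param_succ (η ξ : ℂ) (d : ℤ → ℤ → ℂ) (i : ℤ) :
    param η ξ d i * param η ξ d (i + 1) = exp (η / 2) * (gauge η d (i + 2) / gauge η d i) := by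
  have hx := exp_ne_zero ξ
  have e : exp (η / 2) = exp (η / 4) * exp (η / 4) := by rw [← exp_add]; congr 1; ring
  have h0 := gauge_ne_zero η d
  rcases Int.even_or_odd' i with ⟨j, rfl | rfl⟩
  · rw [param_two_mul, param_two_mul_add_one, e]
    field_simp [h0 (2 * j), h0 (2 * j + 1)]
  · have h2 : 2 * j + 1 + 1 = 2 * (j + 1) := by ring
    rw [h2, param_two_mul, param_two_mul_add_one, e, show 2 * (j + 1) + 1 = 2 * j + 1 + 2 by ring,
      show 2 * (j + 1) = 2 * j + 2 by ring]
    field_simp [h0 (2 * j + 2), h0 (2 * j + 1)]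

theorem param_ne_zero (η ξ : ℂ) (d : ℤ → ℤ → ℂ) (i : ℤ) : param η ξ d i ≠ 0 := by
  unfold param; split_ifs <;> exact exp_ne_zero _

section

variable {g : ℕ} {η : ℂ} {d : ℤ → ℤ → ℂ}

/-- Raising the index of `τ` by `2g + 2` moves `(m, n)` by `(-(g+1), g+1)`. -/
theorem diagonal_periodic {X : Type} {u : ℤ → ℤ → X} (hu : BiPeriodic (g + 1) (g + 1) u)
    (m n : ℤ) : u (m - (g + 1)) (n + (g + 1)) = u m n := by
  rw [(hu _ _).2]
  have := (hu (m - (g + 1)) n).1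
  rw [sub_add_cancel] at this
  exact this.symm

theorem gauge_periodic (hd : BiPeriodic (g + 1) (g + 1) d) (i : ℤ) :
    gauge η d (i + (2 * g + 2)) = gauge η d i := by
  have key := diagonal_periodic hd
  rcases Int.even_or_odd' i with ⟨j, rfl | rfl⟩
  · rw [show 2 * j + (2 * (g : ℤ) + 2) = 2 * (j + (g + 1)) by ring, gauge_two_mul, gauge_two_mul]
    rw [← key (-j) j, ← key (-j) (j + 1)]
    ring_nf
  · rw [show 2 * j + 1 + (2 * (g : ℤ) + 2) = 2 * (j + (g + 1)) + 1 by ring,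
      gauge_two_mul_add_one, gauge_two_mul_add_one]
    rw [← key (-(j + 1)) (j + 1), ← key (-j) (j + 1)]
    ring_nf

theorem param_periodic (ξ : ℂ) (hd : BiPeriodic (g + 1) (g + 1) d) (i : ℤ) :
    param η ξ d (i + (2 * g + 2)) = param η ξ d i := by
  have key := gauge_periodic (η := η) hd
  rcases Int.even_or_odd' i with ⟨j, rfl | rfl⟩
  · rw [show 2 * j + (2 * (g : ℤ) + 2) = 2 * (j + (g + 1)) by ring, param_two_mul, param_two_mul,
      ← key (2 * j), ← key (2 * j + 1)]
    ring_nf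
  · rw [show 2 * j + 1 + (2 * (g : ℤ) + 2) = 2 * (j + (g + 1)) + 1 by ring,
      param_two_mul_add_one, param_two_mul_add_one, ← key (2 * j + 1), ← key (2 * j + 2)]
    ring_nf

theorem isParam_param (ξ : ℂ) (hd : BiPeriodic (g + 1) (g + 1) d) :
    IsParam g (exp ((g + 1) * η / 2)) (param η ξ d) := by
  refine ⟨param_periodic ξ hd, param_ne_zero η ξ d, ?_⟩
  rw [show 2 * g + 2 = 2 * (g + 1) by ring, prod_range_two_mul (fun i => param η ξ d i)]
  push_cast
  simp only [param_mul_param_succ, Finset.prod_mul_distrib, Finset.prod_const, Finset.card_range]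
  have key := prod_range_div_eq_one (n := g + 1) (F := fun j => gauge η d (2 * j))
    (fun i => gauge_ne_zero _ _ _) (by
      have := gauge_periodic (η := η) hd 0
      rw [zero_add] at this
      push_cast
      rw [← this]; ring_nf)
  push_cast at key
  simp only [mul_add, mul_one] at key
  rw [key, mul_one, ← exp_nat_mul]
  congr 1; push_cast; ring

end

section

variable {g : ℕ} {η a ξ : ℂ} {d : ℤ → ℤ → ℂ} {σ : ℤ → ℤ → (Fin 2 ⊕ Fin 2 → ℂ) → ℂ}

theorem tau_periodic (h : IsReduction η (g + 1) (g + 1) d σ) (i n : ℤ) :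
    tau η a ξ σ (i + (2 * g + 2)) n = tau η a ξ σ i n := by
  have key := diagonal_periodic h.periodic
  have hp : point η a ξ (i + (2 * g + 2)) n = point η a ξ i n := by
    have : Even (i + (2 * (g : ℤ) + 2)) ↔ Even i := by
      rw [Int.even_add]
      have : Even (2 * (g : ℤ) + 2) := ⟨g + 1, by ring⟩
      simp only [this, iff_true]
    unfold point
    simp only [this]
  rw [tau, tau, hp]
  rw [show (i + (2 * (g : ℤ) + 2)) / 2 = i / 2 + (g + 1) by omega,
    show (i + (2 * (g : ℤ) + 2)) % 2 = i % 2 by omega,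
    ← key (-(i / 2)) (i / 2 + i % 2)]
  ring_nf

theorem f_periodic (h : IsReduction η (g + 1) (g + 1) d σ) (n i : ℤ) :
    f η a ξ σ n (i + (2 * g + 2)) = f η a ξ σ n i := by
  simp only [f, add_right_comm i _ 2, tau_periodic h]

variable (η a ξ σ) in
/-- `τ_i(n) / τ_i(n-1)`. -/
noncomputable def tauRatio (n i : ℤ) : ℂ := tau η a ξ σ i n / tau η a ξ σ i (n - 1)

theorem f_eq_tauRatio (n i : ℤ) : f η a ξ σ n i = exp (-(η / 4) + a + n * η / 2)
    * (tauRatio η a ξ σ n (i + 2) / tauRatio η a ξ σ n i) := by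
  rw [f, tauRatio, tauRatio, div_div_div_eq, mul_div_assoc]

/-- The quotients of `tauRatio` telescope over indices of one parity, leaving a power of the
prefactor `q^{-1/4} α_n`. It is the same for both parities, hence the constraint. -/
theorem prod_f (h : IsReduction η (g + 1) (g + 1) d σ)
    (hσ : NonvanishingAlong η σ (point η a ξ 0 0)) (n i : ℤ) :
    ∏ j ∈ Finset.range (g + 1), f η a ξ σ n (2 * j + i)
      = exp (-(η / 4) + a + n * η / 2) ^ (g + 1) := by
  simp only [f_eq_tauRatio, Finset.prod_mul_distrib, Finset.prod_const, Finset.card_range]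
  have key := prod_range_div_eq_one (n := g + 1) (F := fun j => tauRatio η a ξ σ n (2 * j + i))
    (fun i => div_ne_zero (tau_ne_zero h hσ _ _) (tau_ne_zero h hσ _ _)) (by
      have e : 2 * ((g + 1 : ℕ) : ℤ) + i = i + (2 * g + 2) := by push_cast; ring
      simp only [e, tauRatio, tau_periodic h, Nat.cast_zero, mul_zero, zero_add])
  have e : ∀ j : ℕ, 2 * ((j + 1 : ℕ) : ℤ) + i = 2 * j + i + 2 := by intro j; push_cast; ring
  simp only [e] at key
  rw [key, mul_one]

/-- This is the monodromy of the cyclic system: the factor `q^{(g+1)/2}` from the parameters cancels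
the powers of `q^{-1/4}` in the `f_i`, leaving `α_n^{2(g+1)}`. -/
theorem prod_param_mul_f (h : IsReduction η (g + 1) (g + 1) d σ)
    (hσ : NonvanishingAlong η σ (point η a ξ 0 0)) (n i : ℤ) :
    ∏ l ∈ Finset.range (2 * g + 2), param η ξ d (i + l) * f η a ξ σ n (i + l)
      = exp (2 * (a + n * η / 2)) ^ (g + 1) := by
  have hd := h.biPeriodic_exponents hσ
  have hf : ∀ i, f η a ξ σ n i ≠ 0 := fun i => by
    have := tau_ne_zero h hσ
    rw [f]
    exact div_ne_zero (mul_ne_zero (exp_ne_zero _) (mul_ne_zero (this _ _) (this _ _)))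
      (mul_ne_zero (this _ _) (this _ _))
  rw [prod_range_add_eq (N := 2 * g + 2) (h := fun i => param η ξ d i * f η a ξ σ n i)
    (fun i => by push_cast; simp only [param_periodic ξ hd, f_periodic h])
    (fun i => mul_ne_zero (param_ne_zero _ _ _ _) (hf i)), Finset.prod_mul_distrib,
    (isParam_param ξ hd).prod_eq, show 2 * g + 2 = 2 * (g + 1) by ring,
    prod_range_two_mul (fun i => f η a ξ σ n i), Finset.prod_mul_distrib]
  have h0 := prod_f h hσ n 0
  have h1 := prod_f h hσ n 1
  simp only [add_zero] at h0
  push_cast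
  rw [h0, h1, ← exp_nat_mul, ← exp_nat_mul, ← exp_add, ← exp_add]
  congr 1; push_cast; ring

/-- The solution in terms of `τ` of the cyclic linear system that determines the polynomials
`Q_i`. -/
noncomputable def cyclicSol (η a ξ : ℂ) (d : ℤ → ℤ → ℂ)
    (σ : ℤ → ℤ → (Fin 2 ⊕ Fin 2 → ℂ) → ℂ) (n i : ℤ) : ℂ :=
  (if Even i then (exp ξ)⁻¹ + (exp (a + n * η / 2))⁻¹ else exp ξ + (exp (a + n * η / 2))⁻¹)
    / gauge η d i * (tau η a ξ σ i (n + 1) * tau η a ξ σ (i + 1) (n - 1))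
    / (tau η a ξ σ i n * tau η a ξ σ (i + 1) n)

/-- This is the bilinear relation divided by `τ_i(n) τ_{i+1}(n)` and the gauge factor, and by `x`
for even `i`. That normalization makes the right side independent of `i`. -/
theorem cyclicSol_sub (h : IsReduction η (g + 1) (g + 1) d σ)
    (hσ : NonvanishingAlong η σ (point η a ξ 0 0)) (n i : ℤ) :
    cyclicSol η a ξ d σ n i - param η ξ d i * f η a ξ σ n i * cyclicSol η a ξ d σ n (i + 1)
      = -(exp (a + n * η / 2) - (exp (a + n * η / 2))⁻¹) := by
  have ht := tau_ne_zero h hσ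
  have h0 := gauge_ne_zero η d
  have hx := exp_ne_zero ξ
  have hα := exp_ne_zero (a + n * η / 2)
  have hq := exp_ne_zero (η / 4)
  have e : exp (-(η / 4) + a + n * η / 2) = (exp (η / 4))⁻¹ * exp (a + n * η / 2) := by
    rw [← exp_neg, ← exp_add]; congr 1; ring
  rcases Int.even_or_odd' i with ⟨j, rfl | rfl⟩
  · have E := bilinear_tau_two_mul h hσ j n rfl rfl
    rw [← gauge_two_mul] at E
    rw [cyclicSol, cyclicSol, if_pos (even_two_mul j), if_neg (by simp), param_two_mul, f, e]
    have t1 := ht (2 * j) n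
    have t2 := ht (2 * j + 1) n
    have t3 := ht (2 * j + 2) n
    have t4 := ht (2 * j + 2) (n - 1)
    have g1 := h0 (2 * j)
    have g2 := h0 (2 * j + 1)
    rw [show 2 * j + 1 + 1 = 2 * j + 2 by ring]
    generalize exp (a + n * η / 2) = α at *
    generalize exp ξ = x at *
    generalize exp (η / 4) = q at *
    field_simp at E ⊢
    linear_combination E
  · have E := bilinear_tau_two_mul_add_one h hσ j n rfl rfl
    rw [← gauge_two_mul_add_one] at E
    rw [cyclicSol, cyclicSol, if_neg (by simp), if_pos (by simp),
      param_two_mul_add_one, f, e, show 2 * j + 1 + 1 = 2 * j + 2 by ring,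
      show 2 * j + 1 + 2 = 2 * j + 3 by ring, show 2 * j + 2 + 1 = 2 * j + 3 by ring]
    have t1 := ht (2 * j + 1) n
    have t2 := ht (2 * j + 2) n
    have t3 := ht (2 * j + 3) n
    have t4 := ht (2 * j + 3) (n - 1)
    have g1 := h0 (2 * j + 1)
    have g2 := h0 (2 * j + 2)
    generalize exp (a + n * η / 2) = α at *
    generalize exp ξ = x at *
    generalize exp (η / 4) = q at *
    field_simp at E ⊢
    linear_combination E

theorem cyclicSol_ne_zero (h : IsReduction η (g + 1) (g + 1) d σ) (hg : Generic g η a ξ)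
    (hσ : NonvanishingAlong η σ (point η a ξ 0 0)) (n i : ℤ) :
    cyclicSol η a ξ d σ n i ≠ 0 := by
  have ht := tau_ne_zero h hσ
  obtain ⟨-, h1, h2⟩ := hg n
  have hx := exp_ne_zero ξ
  have hα := exp_ne_zero (a + n * η / 2)
  rw [exp_neg] at h2
  unfold cyclicSol
  refine div_ne_zero (mul_ne_zero (div_ne_zero ?_ (gauge_ne_zero _ _ _))
    (mul_ne_zero (ht _ _) (ht _ _))) (mul_ne_zero (ht _ _) (ht _ _))
  split_ifs
  · intro h0
    apply h1
    generalize exp (a + n * η / 2) = α at *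
    field_simp at h0
    linear_combination h0
  · intro h0
    apply h2
    linear_combination h0

theorem cyclicSol_periodic (h : IsReduction η (g + 1) (g + 1) d σ)
    (hσ : NonvanishingAlong η σ (point η a ξ 0 0)) (n i : ℤ) :
    cyclicSol η a ξ d σ n (i + (2 * g + 2)) = cyclicSol η a ξ d σ n i := by
  have hd := h.biPeriodic_exponents hσ
  have : Even (i + (2 * (g : ℤ) + 2)) ↔ Even i := by
    rw [Int.even_add]
    have : Even (2 * (g : ℤ) + 2) := ⟨g + 1, by ring⟩
    simp only [this, iff_true]
  simp only [cyclicSol, this, gauge_periodic hd, add_right_comm i _ 1, tau_periodic h]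

/-- `Q_i` in terms of `τ`. -/
theorem poly_eq (h : IsReduction η (g + 1) (g + 1) d σ) (hg : Generic g η a ξ)
    (hσ : NonvanishingAlong η σ (point η a ξ 0 0)) (n : ℤ) :
    ∃ c : ℂ, c ≠ 0 ∧ ∀ i, poly (2 * g + 2) (param η ξ d) (f η a ξ σ n) i
      = c * cyclicSol η a ξ d σ n i := by
  have hα := exp_ne_zero (a + n * η / 2)
  -- `α_n^{2(g+1)} ≠ 1` forces `α_n² ≠ 1`, so the inhomogeneity of the cyclic system is nonzero.
  have h1 : exp (2 * (a + n * η / 2)) ≠ 1 := fun h0 => (hg n).1 (by rw [h0, one_pow])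
  have hc : -(exp (a + n * η / 2) - (exp (a + n * η / 2))⁻¹) ≠ 0 := by
    intro h0
    apply h1
    rw [two_mul, exp_add]
    generalize exp (a + n * η / 2) = α at *
    field_simp at h0
    linear_combination -h0
  refine ⟨(1 - exp (2 * (a + n * η / 2)) ^ (g + 1))
    / -(exp (a + n * η / 2) - (exp (a + n * η / 2))⁻¹),
    div_ne_zero (sub_ne_zero.2 (hg n).1.symm) hc, fun i => ?_⟩
  have key := poly_eq_of_cyclic (cyclicSol_sub h hσ n) (2 * g + 2) i
  rw [prod_param_mul_f h hσ] at key
  push_cast at key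
  rw [cyclicSol_periodic h hσ] at key
  rw [div_mul_eq_mul_div, eq_div_iff hc]
  linear_combination -key

/-- By `poly_eq`, `Q_{i+2}/Q_i` is the quotient of two `cyclicSol`, in which the coefficient
depending on the parity of `i` cancels. The evolution equation is then an identity between monomials
in tau functions. -/
theorem isSolution_f (h : IsReduction η (g + 1) (g + 1) d σ) (hg : Generic g η a ξ)
    (hσ : NonvanishingAlong η σ (point η a ξ 0 0)) :
    IsSolution g (param η ξ d) (f η a ξ σ) := by
  have ht := tau_ne_zero h hσ
  refine ⟨fun n i => f_periodic h n i, fun n i => ?_, fun n => ?_, fun n i => ?_, fun n i => ?_⟩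
  · rw [f]
    exact div_ne_zero (mul_ne_zero (exp_ne_zero _) (mul_ne_zero (ht _ _) (ht _ _)))
      (mul_ne_zero (ht _ _) (ht _ _))
  · have h0 := prod_f h hσ n 0
    simp only [add_zero] at h0
    rw [h0, prod_f h hσ n 1]
  · obtain ⟨c, hc, hp⟩ := poly_eq h hg hσ n
    rw [hp]
    exact mul_ne_zero hc (cyclicSol_ne_zero h hg hσ n i)
  · obtain ⟨c, hc, hp⟩ := poly_eq h hg hσ n
    have hX := cyclicSol_ne_zero h hg hσ n i
    rw [hp, hp, mul_div_assoc, mul_div_mul_left _ _ hc, param_mul_param_succ,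
      ← mul_div_assoc, eq_div_iff hX]
    have e : exp (-(η / 4) + a + (n + 1 : ℤ) * η / 2)
        = exp (η / 2) * exp (-(η / 4) + a + n * η / 2) := by
      rw [← exp_add]; congr 1; push_cast; ring
    have he : Even (i + 2) ↔ Even i := by simp
    rw [f, f, cyclicSol, cyclicSol, e, add_sub_cancel_right]
    simp only [he]
    rw [show i + 1 + 2 = i + 3 by ring, show i + 2 + 1 = i + 3 by ring]
    have g1 := gauge_ne_zero η d i
    have g2 := gauge_ne_zero η d (i + 2)
    have t1 := ht i n
    have t2 := ht (i + 1) n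
    have t3 := ht (i + 2) n
    have t4 := ht (i + 3) n
    have t5 := ht i (n + 1)
    have t6 := ht (i + 1) (n - 1)
    have t7 := ht (i + 3) (n - 1)
    generalize (if Even i then (exp ξ)⁻¹ + (exp (a + n * η / 2))⁻¹
      else exp ξ + (exp (a + n * η / 2))⁻¹) = k
    field_simp

end

end QPainleveA

/-! ### Type A: all parameters arise -/

namespace QPainleveA

open Complex LatticeQUC

/-- Periodic logarithms of the parameters with prescribed sum. -/
theorem exists_log_param {g : ℕ} {c : ℂ} {p : ℤ → ℂ} (hp : IsParam g (exp c) p) :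
    ∃ L : ℤ → ℂ, (∀ i, exp (L i) = p i) ∧ (∀ i, L (i + (2 * g + 2)) = L i) ∧
      ∑ i ∈ Finset.range (2 * g + 2), L i = c := by
  have h1 : exp (∑ i ∈ Finset.range (2 * g + 2), log (p i)) = exp c := by
    rw [exp_sum, ← hp.prod_eq]
    exact Finset.prod_congr rfl fun i _ => exp_log (hp.ne_zero _)
  obtain ⟨k, hk⟩ := exp_eq_exp_iff_exists_int.1 h1
  -- The principal logarithms have the right sum up to a multiple of `2πi`, which is subtracted at
  -- the residue class of `0` only.
  refine ⟨fun i => log (p i) - (if i % (2 * g + 2) = 0 then k * (2 * Real.pi * I) else 0),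
    fun i => ?_, fun i => ?_, ?_⟩
  · simp only
    rw [exp_sub, exp_log (hp.ne_zero i)]
    split_ifs
    · rw [exp_int_mul_two_pi_mul_I, div_one]
    · rw [exp_zero, div_one]
  · simp only [hp.periodic, Int.add_emod_right]
  · rw [Finset.sum_sub_distrib, hk]
    have : ∑ i ∈ Finset.range (2 * g + 2),
        (if (i : ℤ) % (2 * g + 2) = 0 then k * (2 * Real.pi * I) else 0)
        = k * (2 * Real.pi * I) := by
      rw [Finset.sum_eq_single 0]
      · simp
      · intro i hi hi0
        rw [if_neg]
        rw [Finset.mem_range] at hi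
        rw [Int.emod_eq_of_lt (by omega) (by omega)]
        exact_mod_cast hi0
      · simp
    rw [this, add_sub_cancel_right]

theorem sum_range_two_mul (h : ℕ → ℂ) (n : ℕ) :
    ∑ i ∈ Finset.range (2 * n), h i = ∑ j ∈ Finset.range n, (h (2 * j) + h (2 * j + 1)) := by
  induction n with
  | zero => simp
  | succ n ih =>
    rw [Finset.sum_range_succ, ← ih, show 2 * (n + 1) = 2 * n + 1 + 1 by ring,
      Finset.sum_range_succ, Finset.sum_range_succ, add_assoc]

/-- All parameters of the q-Painlevé equation of type `A_{2g+1}^{(1)}` arise. -/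
theorem exists_exponents {η : ℂ} (hη : η ≠ 0) {g : ℕ} {p : ℤ → ℂ}
    (hp : IsParam g (exp ((g + 1) * η / 2)) p) :
    ∃ (d : ℤ → ℤ → ℂ) (ξ : ℂ), Balanced d ∧ BiPeriodic (g + 1) (g + 1) d ∧
      p = param η ξ d := by
  obtain ⟨L, hL, hLp, hLs⟩ := exists_log_param hp
  rw [show 2 * g + 2 = 2 * (g + 1) by ring, sum_range_two_mul (fun i => L i)] at hLs
  push_cast at hLs
  have hM : ((g : ℂ) + 1) ≠ 0 := by exact_mod_cast Nat.succ_ne_zero g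
  have hA : ∀ j : ℤ, L (2 * (j + (g + 1 : ℕ))) = L (2 * j) := fun j => by
    rw [← hLp (2 * j)]; congr 1; push_cast; ring
  have hB : ∀ j : ℤ, L (2 * (j + (g + 1 : ℕ)) + 1) = L (2 * j + 1) := fun j => by
    rw [← hLp (2 * j + 1)]; congr 1; push_cast; ring
  -- For `d_{m,n} = u(-m) + v(n)`, the sum of the logarithms of `a_{2j}` and `a_{2j+1}` involves
  -- only the second difference of `v`. Here `W` is the first difference of `v` up to a constant,
  -- and its mean `wm` is subtracted so that `v` can be periodic. The equation for `a_{2j}` then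
  -- prescribes the difference of `u`, and `ξ` is the value for which this has zero sum over a
  -- period.
  obtain ⟨W, hWp, hW⟩ := exists_periodic_antidifference (Nat.succ_pos g)
    (h := fun j => -(2 / η) * (L (2 * j) + L (2 * j + 1) - η / 2))
    (fun j => by simp only [Nat.succ_eq_add_one, hA, hB])
    (by
      rw [← Finset.mul_sum, Finset.sum_sub_distrib, hLs]
      simp only [Finset.sum_const, Finset.card_range, nsmul_eq_mul]
      push_cast; ring)
  set wm : ℂ := (∑ j ∈ Finset.range (g + 1), W j) / (g + 1) with hwm
  set ξ : ℂ := η / 4 - (∑ j ∈ Finset.range (g + 1), L (2 * j)) / (g + 1) with hξ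
  have hWs : ∑ j ∈ Finset.range (g + 1), (W j - wm) = 0 := by
    rw [Finset.sum_sub_distrib, hwm]
    simp only [Finset.sum_const, Finset.card_range, nsmul_eq_mul]
    push_cast; field_simp; ring
  obtain ⟨v, hvp, hv⟩ := exists_periodic_antidifference (Nat.succ_pos g)
    (h := fun j => W j - wm) (fun j => by simp only [hWp]) hWs
  obtain ⟨u, hup, hu⟩ := exists_periodic_antidifference (Nat.succ_pos g)
    (h := fun j => 2 / η * (L (2 * j) - η / 4 + ξ) - (W j - wm))
    (fun j => by simp only [hWp, Nat.succ_eq_add_one, hA])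
    (by
      rw [Finset.sum_sub_distrib, hWs, ← Finset.mul_sum, Finset.sum_add_distrib,
        Finset.sum_sub_distrib, hξ]
      simp only [Finset.sum_const, Finset.card_range, nsmul_eq_mul]
      push_cast; field_simp; ring)
  refine ⟨fun m n => u (-m) + v n, ξ, fun m n => by ring, fun m n => ⟨?_, ?_⟩, ?_⟩
  · simp only
    rw [← hup (-(m + (g + 1)))]
    congr 2; push_cast; ring
  · simp only
    rw [← hvp n]
    push_cast; rfl
  · funext i
    rcases Int.even_or_odd' i with ⟨j, rfl | rfl⟩
    · rw [param, if_pos (even_two_mul j), Int.mul_ediv_cancel_left _ two_ne_zero, ← hL]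
      congr 1
      rw [show -(-j - 1) = j + 1 by ring, neg_neg]
      have h1 := hv j
      have h2 := hu j
      have h3 : η * (u (j + 1) + v (j + 1) - (u j + v j)) = 2 * (L (2 * j) - η / 4 + ξ) := by
        rw [show u (j + 1) + v (j + 1) - (u j + v j)
          = (u (j + 1) - u j) + (v (j + 1) - v j) by ring, h1, h2]
        field_simp; ring
      linear_combination -(1 / 2) * h3
    · rw [param, if_neg (by simp), show (2 * j + 1) / 2 = j by omega, ← hL]
      congr 1
      rw [show -(-j - 1) = j + 1 by ring, neg_neg]
      have h1 := hv (j + 1)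
      have h2 := hu j
      have h4 := hW j
      rw [show j + 1 + 1 = j + 2 by ring] at h1
      have h3 : η * (u j + v (j + 1) - (u (j + 1) + v (j + 2)))
          = 2 * (L (2 * j + 1) - η / 4 - ξ) := by
        rw [show u j + v (j + 1) - (u (j + 1) + v (j + 2))
          = -(u (j + 1) - u j) - (v (j + 2) - v (j + 1)) by ring, h1, h2,
          show W (j + 1) = (W (j + 1) - W j) + W j by ring, h4]
        field_simp; ring
      linear_combination -(1 / 2) * h3

end QPainleveA

/-! ### Type E: the Weyl group action and the factorization of `ℓ` -/

namespace QPainleveE6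

open Complex LatticeQUC

/-! ### The action of the simple reflections in logarithmic coordinates -/

/-- The simple reflection `s_i` on the logarithms of the parameters. -/
def refl (i : Fin 7) (A : Fin 7 → ℂ) : Fin 7 → ℂ := fun j => A j - cartan i j * A i

theorem act_roots (i : Fin 7) (A : Fin 7 → ℂ) (p : ℂ × ℂ) :
    act i (roots A, p) = (roots (refl i A), (act i (roots A, p)).2) := by
  refine Prod.ext (funext fun j => ?_) rfl
  simp only [act, roots, refl]
  rw [← exp_int_mul, ← exp_add]
  congr 1; push_cast; ring

theorem act_roots_of_ne {i : Fin 7} (hi : i ≠ 3) (A : Fin 7 → ℂ) (p : ℂ × ℂ) :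
    act i (roots A, p) = (roots (refl i A), p) := by
  rw [act_roots, act, if_neg hi]

/-- The action of `s_2 s_4 s_6 s_3` on the logarithms of the parameters. -/
def phi (A : Fin 7 → ℂ) : Fin 7 → ℂ :=
  ![A 0 + A 6 + A 3, A 1 + A 2 + A 3, -(A 2 + A 3), A 2 + A 4 + A 6 + 2 * A 3, -(A 4 + A 3),
    A 5 + A 4 + A 3, -(A 6 + A 3)]

/-- The action of `s_2 s_4 s_6 s_0 s_1 s_5 s_3` on the logarithms of the parameters. -/
def psi (A : Fin 7 → ℂ) : Fin 7 → ℂ :=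
  ![A 6 + A 3, A 2 + A 3, -(A 1 + A 2 + A 3), A 0 + A 1 + A 5 + A 2 + A 4 + A 6 + 2 * A 3,
    -(A 3 + A 4 + A 5), A 3 + A 4, -(A 0 + A 3 + A 6)]

theorem refl_phi (A : Fin 7 → ℂ) : refl 2 (refl 4 (refl 6 (refl 3 A))) = phi A := by
  funext j
  fin_cases j <;> simp [refl, phi, cartan] <;> ring

theorem refl_psi (A : Fin 7 → ℂ) :
    refl 2 (refl 4 (refl 6 (refl 0 (refl 1 (refl 5 (refl 3 A)))))) = psi A := by
  funext j
  fin_cases j <;> simp [refl, psi, cartan] <;> ring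

theorem run_phi (A : Fin 7 → ℂ) (p : ℂ × ℂ) :
    run [2, 4, 6, 3] (roots A, p) = (roots (phi A), (act 3 (roots A, p)).2) := by
  simp only [run, List.foldr]
  rw [act_roots 3, act_roots_of_ne (by decide), act_roots_of_ne (by decide),
    act_roots_of_ne (by decide), refl_phi]

theorem run_psi (A : Fin 7 → ℂ) (p : ℂ × ℂ) :
    run [2, 4, 6, 0, 1, 5, 3] (roots A, p) = (roots (psi A), (act 3 (roots A, p)).2) := by
  simp only [run, List.foldr]
  rw [act_roots 3, act_roots_of_ne (by decide), act_roots_of_ne (by decide),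
    act_roots_of_ne (by decide), act_roots_of_ne (by decide), act_roots_of_ne (by decide),
    act_roots_of_ne (by decide), refl_psi]

/-- The composite adds to each logarithm an integer multiple of the linear form that `IsParam` sets
equal to `η`. -/
theorem psi_phi_psi_phi {η : ℂ} {A : Fin 7 → ℂ} (hA : IsParam η A) :
    psi (phi (psi (phi A))) = bar η A := by
  unfold IsParam at hA
  subst hA
  funext j
  fin_cases j <;> simp [psi, phi, bar] <;> ring

theorem run_append (w w' : List (Fin 7)) (s : State) : run (w ++ w') s = run w (run w' s) :=
  List.foldr_append

theorem defined_append (w w' : List (Fin 7)) (s : State) :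
    Defined (w ++ w') s ↔ Defined w' s ∧ Defined w (run w' s) := by
  induction w with
  | nil => simp [Defined]
  | cons i w ih => rw [List.cons_append, Defined, Defined, ih, run_append, and_assoc]

theorem defined_phi {s : State} (h : den s ≠ 0) : Defined [2, 4, 6, 3] s := by
  simpa [Defined, run] using h

theorem defined_psi {s : State} (h : den s ≠ 0) : Defined [2, 4, 6, 0, 1, 5, 3] s := by
  simpa [Defined, run] using h

theorem ell_eq : ell = [2, 4, 6, 0, 1, 5, 3] ++ ([2, 4, 6, 3] ++
    ([2, 4, 6, 0, 1, 5, 3] ++ [2, 4, 6, 3])) := rfl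

/-- Evaluation of `ℓ`, given the results of the four applications of `s_3`. -/
theorem solvesAt_of_steps {η : ℂ} {A : Fin 7 → ℂ} (hA : IsParam η A)
    {f g : (Fin 7 → ℂ) → ℂ} {p₁ p₂ p₃ : ℂ × ℂ}
    (h₀ : den (roots A, (f A, g A)) ≠ 0 ∧ (act 3 (roots A, (f A, g A))).2 = p₁)
    (h₁ : den (roots (phi A), p₁) ≠ 0 ∧ (act 3 (roots (phi A), p₁)).2 = p₂)
    (h₂ : den (roots (psi (phi A)), p₂) ≠ 0 ∧ (act 3 (roots (psi (phi A)), p₂)).2 = p₃)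
    (h₃ : den (roots (phi (psi (phi A))), p₃) ≠ 0 ∧
      (act 3 (roots (phi (psi (phi A))), p₃)).2 = (f (bar η A), g (bar η A))) :
    SolvesAt η f g A := by
  have e₁ : run [2, 4, 6, 3] (roots A, f A, g A) = (roots (phi A), p₁) := by
    rw [run_phi, h₀.2]
  have e₂ : run ([2, 4, 6, 0, 1, 5, 3] ++ [2, 4, 6, 3]) (roots A, f A, g A)
      = (roots (psi (phi A)), p₂) := by
    rw [run_append, e₁, run_psi, h₁.2]
  have e₃ : run ([2, 4, 6, 3] ++ ([2, 4, 6, 0, 1, 5, 3] ++ [2, 4, 6, 3])) (roots A, f A, g A)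
      = (roots (phi (psi (phi A))), p₃) := by
    rw [run_append, e₂, run_phi, h₂.2]
  rw [SolvesAt, ell_eq, run_append, defined_append, e₃, run_psi, h₃.2, psi_phi_psi_phi hA,
    defined_append, e₂, defined_append, e₁]
  exact ⟨⟨⟨⟨defined_phi h₀.1, defined_psi h₁.1⟩, defined_phi h₂.1⟩, defined_psi h₃.1⟩, rfl⟩

/-! ### Reflections of the tau functions -/

/-- The effect of `s_3` on ratios of triple products, one factor of which is replaced by a
solution of bilinear relations. -/
theorem act_three_of_bilinear {A : Fin 7 → ℂ} {r : ℂ} (hr : exp (A 3) = r⁻¹) (hr0 : r ≠ 0)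
    (hr3 : r ^ 3 ≠ 1) {u₁ u₂ u₃ u₁' u₂' u₃' v₁ v₂ v₃ : ℂ} (hu₁ : u₁ ≠ 0) (hu₂ : u₂ ≠ 0)
    (hu₃ : u₃ ≠ 0) (hu₃' : u₃' ≠ 0) (hv₃ : v₃ ≠ 0)
    (h₁ : u₂' * u₃ - r * (u₂ * u₃') = (1 - r) * cx (roots A) * v₁)
    (h₂ : u₃' * u₁ - r * (u₃ * u₁') = (1 - r) * cy (roots A) * v₂)
    (h₃ : u₁' * u₂ - r * (u₁ * u₂') = (1 - r) * cz (roots A) * v₃)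
    {p p' : ℂ × ℂ} (hp : p = (u₁ * v₁ / (u₃ * v₃), u₂ * v₂ / (u₃ * v₃)))
    (hp' : p' = (u₁' * v₁ / (u₃' * v₃), u₂' * v₂ / (u₃' * v₃))) :
    den (roots A, p) ≠ 0 ∧ (act 3 (roots A, p)).2 = p' := by
  have hκ : roots A 3 ^ 3 = r⁻¹ := by
    rw [← hr, roots, ← exp_nat_mul]; congr 1; push_cast; ring
  have hr1 : 1 - r ≠ 0 := fun h => hr3 (by rw [show r = 1 by linear_combination -h]; ring)
  have hr3' : 1 - r ^ 3 ≠ 0 := sub_ne_zero.2 hr3.symm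
  generalize hX : cx (roots A) = X at *
  generalize hY : cy (roots A) = Y at *
  generalize hZ : cz (roots A) = Z at *
  -- Weighting the three relations by `1, r, r²` in cyclic order makes all products telescope except
  -- one, which appears with coefficient `1 - r³`. So the denominator and both numerators of `s_3`
  -- become monomials, and the denominator is nonzero because `u₃'` and `1 - r³` are.
  have M₃ : r ^ 2 * X * (u₁ * v₁) + Y * (u₂ * v₂) + r * Z * (u₃ * v₃)
      = (1 - r ^ 3) / (1 - r) * (u₃' * u₁ * u₂) := by
    field_simp
    linear_combination -(u₂ * h₂ + r * u₃ * h₃ + r ^ 2 * u₁ * h₁)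
  have M₁ : r * X * (u₁ * v₁) + r ^ 2 * Y * (u₂ * v₂) + Z * (u₃ * v₃)
      = (1 - r ^ 3) / (1 - r) * (u₁' * u₂ * u₃) := by
    field_simp
    linear_combination -(u₃ * h₃ + r * u₁ * h₁ + r ^ 2 * u₂ * h₂)
  have M₂ : X * (u₁ * v₁) + r * Y * (u₂ * v₂) + r ^ 2 * Z * (u₃ * v₃)
      = (1 - r ^ 3) / (1 - r) * (u₂' * u₃ * u₁) := by
    field_simp
    linear_combination -(u₁ * h₁ + r * u₂ * h₂ + r ^ 2 * u₃ * h₃)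
  have hk : (1 - r ^ 3) / (1 - r) ≠ 0 := div_ne_zero hr3' hr1
  generalize (1 - r ^ 3) / (1 - r) = k at *
  have D₃ : den (roots A, p) = k * (u₃' * u₁ * u₂) / (r * (u₃ * v₃)) := by
    rw [← M₃, den, hκ, hp]
    simp only [hX, hY, hZ]
    field_simp
  have D₁ : X * p.1 + r * Y * p.2 + r⁻¹ * Z = k * (u₁' * u₂ * u₃) / (r * (u₃ * v₃)) := by
    rw [← M₁, hp]
    field_simp
  have D₂ : r⁻¹ * X * p.1 + Y * p.2 + r * Z = k * (u₂' * u₃ * u₁) / (r * (u₃ * v₃)) := by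
    rw [← M₂, hp]
    field_simp
  refine ⟨?_, ?_⟩
  · rw [D₃]; positivity
  · simp only [act, if_true, hκ, inv_inv, hX, hY, hZ]
    rw [D₁, D₂, D₃, hp, hp']
    refine Prod.ext ?_ ?_ <;> simp only <;> field_simp

end QPainleveE6

/-! ### Type E: bilinear relations on antidiagonals -/

namespace QPainleveE6

open Complex LatticeQUC

section

variable {η : ℂ} {d : ℤ → ℤ → ℂ} {σ : ℤ → ℤ → (Fin 3 ⊕ Empty → ℂ) → ℂ}

/-- The bilinear relations after normalization of the arguments by the similarity condition. -/
theorem bilinear_normalized (h : IsReduction η 3 3 d σ) (m n : ℤ) (i j : Fin 3)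
    {θ new old mid : Fin 3 ⊕ Empty → ℂ} (hnew : ∀ k, shift η (.inl i) θ k = new k + η / 3)
    (hold : ∀ k, shift η (.inl j) θ k = old k + η / 3)
    (hmid : ∀ k, shift η (.inl i) (shift η (.inl j) θ) k = mid k + 2 * η / 3) :
    σ m (n + 1) new * σ (m + 1) n old
      - exp (θ (.inl j) - θ (.inl i)) * (σ m (n + 1) old * σ (m + 1) n new)
      = (1 - exp (θ (.inl j) - θ (.inl i))) * exp (η * (d m n - d (m + 1) (n + 1)) / 3)
        * (σ m n mid * σ (m + 1) (n + 1) θ) := by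
  have E := h.hierarchy m n (.inl i) (.inl j) θ
  rw [h.similar' m (n + 1) _ hnew, h.similar' (m + 1) n _ hold, h.similar' m (n + 1) _ hold,
    h.similar' (m + 1) n _ hnew, h.similar' m n _ hmid] at E
  have e : exp (d m n * (2 * η / 3)) = exp (d m (n + 1) * (η / 3)) * exp (d (m + 1) n * (η / 3))
      * exp (η * (d m n - d (m + 1) (n + 1)) / 3) := by
    rw [← exp_add, ← exp_add]
    congr 1
    linear_combination (η / 3) * h.balanced m n
  rw [e] at E
  have h1 := exp_ne_zero (d m (n + 1) * (η / 3))
  have h2 := exp_ne_zero (d (m + 1) n * (η / 3))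
  have h3 := exp_ne_zero (θ (.inl i))
  rw [exp_sub]
  generalize exp (d m (n + 1) * (η / 3)) = s1 at *
  generalize exp (d (m + 1) n * (η / 3)) = s2 at *
  generalize exp (η * (d m n - d (m + 1) (n + 1)) / 3) = s3 at *
  generalize exp (θ (.inl i)) = t1 at *
  generalize exp (θ (.inl j)) = t2 at *
  field_simp at E ⊢
  linear_combination E

/-- The tau functions on the antidiagonals. -/
def diag (σ : ℤ → ℤ → (Fin 3 ⊕ Empty → ℂ) → ℂ) (c i : ℤ) : (Fin 3 ⊕ Empty → ℂ) → ℂ :=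
  σ (i + c) (-i + c)

theorem diag_add_three_left (h : IsReduction η 3 3 d σ) (c i : ℤ) :
    diag σ (c + 3) i = diag σ c i := by
  rw [diag, diag, ← add_assoc, ← add_assoc, (h.periodic _ _).1, (h.periodic _ _).2]

theorem diag_add_three_right (h : IsReduction η 3 3 d σ) (c i : ℤ) :
    diag σ c (i + 3) = diag σ c i := by
  rw [diag, diag, show i + 3 + c = i + c + 3 by ring, (h.periodic _ _).1,
    ← (h.periodic _ (-(i + 3) + c)).2]
  congr 1; ring

/-- In one equation of the hierarchy, `(m, n+1)` and `(m+1, n)` lie modulo 3 on the same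
antidiagonal `c`, while `(m, n)` and `(m+1, n+1)` lie on `c + 1` and `c + 2` with a common index.
This is the shape needed for `s_3`: two tau functions of one family against a product of the other
two families. -/
theorem bilinear_diag (h : IsReduction η 3 3 d σ) (c k : ℤ) (i j : Fin 3)
    {θ new old mid : Fin 3 ⊕ Empty → ℂ} (hnew : ∀ k, shift η (.inl i) θ k = new k + η / 3)
    (hold : ∀ k, shift η (.inl j) θ k = old k + η / 3)
    (hmid : ∀ k, shift η (.inl i) (shift η (.inl j) θ) k = mid k + 2 * η / 3) :
    diag σ c (k + 1) new * diag σ c (k + 2) old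
      - exp (θ (.inl j) - θ (.inl i)) * (diag σ c (k + 1) old * diag σ c (k + 2) new)
      = (1 - exp (θ (.inl j) - θ (.inl i)))
        * exp (η * (d (k + c + 1) (-k + c + 1) - d (k + c + 2) (-k + c + 2)) / 3)
        * (diag σ (c + 1) k mid * diag σ (c + 2) k θ) := by
  have E := bilinear_normalized h (k + c + 1) (-k + c + 1) i j hnew hold hmid
  have e1 : diag σ c (k + 1) = σ (k + c + 1) (-k + c + 1 + 1) := by
    rw [diag, ← (h.periodic _ (-(k + 1) + c)).2]; congr 1 <;> ring
  have e2 : diag σ c (k + 2) = σ (k + c + 1 + 1) (-k + c + 1) := by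
    rw [diag, ← (h.periodic _ (-(k + 2) + c)).2]; congr 1 <;> ring
  have e3 : diag σ (c + 1) k = σ (k + c + 1) (-k + c + 1) := by
    rw [diag]; congr 1 <;> ring
  have e4 : diag σ (c + 2) k = σ (k + c + 1 + 1) (-k + c + 1 + 1) := by
    rw [diag]; congr 1 <;> ring
  rw [e1, e2, e3, e4, E]
  rw [show k + c + 1 + 1 = k + c + 2 by ring, show -k + c + 1 + 1 = -k + c + 2 by ring]

/-- `s_3` replaces one of the three factors of the dependent variables. -/
theorem act_three_of_diag (h : IsReduction η 3 3 d σ) (c : ℤ) (i j : Fin 3)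
    {θ new old mid : Fin 3 ⊕ Empty → ℂ} (hnew : ∀ k, shift η (.inl i) θ k = new k + η / 3)
    (hold : ∀ k, shift η (.inl j) θ k = old k + η / 3)
    (hmid : ∀ k, shift η (.inl i) (shift η (.inl j) θ) k = mid k + 2 * η / 3)
    (hnew0 : ∀ k, diag σ c k new ≠ 0) (hold0 : ∀ k, diag σ c k old ≠ 0)
    (hmid0 : ∀ k, diag σ (c + 1) k mid ≠ 0) (hθ0 : ∀ k, diag σ (c + 2) k θ ≠ 0)
    (hr3 : exp (3 * θ (.inl j)) ≠ exp (3 * θ (.inl i)))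
    {A : Fin 7 → ℂ} (hA3 : A 3 = θ (.inl i) - θ (.inl j))
    (hx : A 1 + 2 * A 2 - 2 * A 4 - A 5 = η * (d (c + 2) c - d (c + 3) (c + 1)))
    (hy : A 5 + 2 * A 4 - 2 * A 6 - A 0 = η * (d (c + 3) (c - 1) - d (c + 4) c))
    (hz : A 0 + 2 * A 6 - 2 * A 2 - A 1 = η * (d (c + 4) (c - 2) - d (c + 5) (c - 1)))
    {p p' : ℂ × ℂ}
    (hp : p = (diag σ c 1 old * (diag σ (c + 1) 1 mid * diag σ (c + 2) 1 θ)
        / (diag σ c 3 old * (diag σ (c + 1) 3 mid * diag σ (c + 2) 3 θ)),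
      diag σ c 2 old * (diag σ (c + 1) 2 mid * diag σ (c + 2) 2 θ)
        / (diag σ c 3 old * (diag σ (c + 1) 3 mid * diag σ (c + 2) 3 θ))))
    (hp' : p' = (diag σ c 1 new * (diag σ (c + 1) 1 mid * diag σ (c + 2) 1 θ)
        / (diag σ c 3 new * (diag σ (c + 1) 3 mid * diag σ (c + 2) 3 θ)),
      diag σ c 2 new * (diag σ (c + 1) 2 mid * diag σ (c + 2) 2 θ)
        / (diag σ c 3 new * (diag σ (c + 1) 3 mid * diag σ (c + 2) 3 θ)))) :
    den (roots A, p) ≠ 0 ∧ (act 3 (roots A, p)).2 = p' := by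
  have cxe : cx (roots A) = exp ((A 1 + 2 * A 2 - 2 * A 4 - A 5) / 3) := by
    simp only [cx, roots, ← exp_nat_mul, ← exp_add, ← exp_sub]
    congr 1; push_cast; ring
  have cye : cy (roots A) = exp ((A 5 + 2 * A 4 - 2 * A 6 - A 0) / 3) := by
    simp only [cy, roots, ← exp_nat_mul, ← exp_add, ← exp_sub]
    congr 1; push_cast; ring
  have cze : cz (roots A) = exp ((A 0 + 2 * A 6 - 2 * A 2 - A 1) / 3) := by
    simp only [cz, roots, ← exp_nat_mul, ← exp_add, ← exp_sub]
    congr 1; push_cast; ring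
  -- Reducing the indices 4 and 5 closes the relations for `k = 1, 2, 3` into the cyclic triple of
  -- `act_three_of_bilinear`.
  have q1 : diag σ c 4 = diag σ c 1 := diag_add_three_right h c 1
  have q2 : diag σ c 5 = diag σ c 2 := diag_add_three_right h c 2
  have E1 := bilinear_diag h c 1 i j hnew hold hmid
  have E2 := bilinear_diag h c 2 i j hnew hold hmid
  have E3 := bilinear_diag h c 3 i j hnew hold hmid
  norm_num only at E1 E2 E3
  rw [q1] at E2
  rw [q1, q2] at E3
  refine act_three_of_bilinear (r := exp (θ (.inl j) - θ (.inl i))) ?_ (exp_ne_zero _) ?_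
    (hold0 1) (hold0 2) (hold0 3) (hnew0 3) (mul_ne_zero (hmid0 3) (hθ0 3)) ?_ ?_ ?_ hp hp'
  · rw [hA3, ← exp_neg]; congr 1; ring
  · intro h1
    apply hr3
    rw [← exp_nat_mul, Nat.cast_ofNat, mul_sub, exp_sub, div_eq_one_iff_eq (exp_ne_zero _)] at h1
    exact h1
  · rw [E1, cxe, hx]; ring_nf
  · rw [E2, cye, hy]; ring_nf
  · rw [E3, cze, hz]; ring_nf

end

/-- The point `(u, v)` shifted by `p_i η`. -/
noncomputable def ptE (η u v p₁ p₂ p₃ : ℂ) : Fin 3 ⊕ Empty → ℂ :=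
  Sum.elim ![-u + p₁ * η, -v + p₂ * η, u + v + p₃ * η] Empty.elim

theorem forall_sum_fin_three {p : Fin 3 ⊕ Empty → Prop} :
    (∀ i, p i) ↔ p (.inl 0) ∧ p (.inl 1) ∧ p (.inl 2) := by
  rw [Sum.forall, Fin.forall_fin_succ, Fin.forall_fin_two]
  simp

section

variable (η u v p₁ p₂ p₃ : ℂ)

@[simp] theorem ptE_zero : ptE η u v p₁ p₂ p₃ (.inl 0) = -u + p₁ * η := rfl
@[simp] theorem ptE_one : ptE η u v p₁ p₂ p₃ (.inl 1) = -v + p₂ * η := rfl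
@[simp] theorem ptE_two : ptE η u v p₁ p₂ p₃ (.inl 2) = u + v + p₃ * η := rfl

theorem shift_ptE_zero :
    shift η (.inl 0) (ptE η u v p₁ p₂ p₃) = ptE η u v (p₁ + 1) p₂ p₃ := by
  funext i; revert i; rw [forall_sum_fin_three]; simp [shift, add_mul, add_assoc]

theorem shift_ptE_one :
    shift η (.inl 1) (ptE η u v p₁ p₂ p₃) = ptE η u v p₁ (p₂ + 1) p₃ := by
  funext i; revert i; rw [forall_sum_fin_three]; simp [shift, add_mul, add_assoc]

theorem shift_ptE_two :
    shift η (.inl 2) (ptE η u v p₁ p₂ p₃) = ptE η u v p₁ p₂ (p₃ + 1) := by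
  funext i; revert i; rw [forall_sum_fin_three]; simp [shift, add_mul, add_assoc]

variable {η u v p₁ p₂ p₃}

theorem ptE_eq_add {p₁' p₂' p₃' : ℂ} (s : ℂ) (h₁ : p₁' = p₁ + s) (h₂ : p₂' = p₂ + s)
    (h₃ : p₃' = p₃ + s) (k : Fin 3 ⊕ Empty) :
    ptE η u v p₁' p₂' p₃' k = ptE η u v p₁ p₂ p₃ k + s * η := by
  revert k; rw [forall_sum_fin_three, h₁, h₂, h₃]; simp [add_mul, add_assoc]

theorem ptE_ne_zero {d : ℤ → ℤ → ℂ} {σ : ℤ → ℤ → (Fin 3 ⊕ Empty → ℂ) → ℂ}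
    (h : IsReduction η 3 3 d σ) (hσ : NonvanishingAlong η σ (point u v)) (k₁ k₂ k₃ : ℤ) (s : ℂ)
    (h₁ : p₁ = k₁ + s) (h₂ : p₂ = k₂ + s) (h₃ : p₃ = k₃ + s) (m n : ℤ) :
    σ m n (ptE η u v p₁ p₂ p₃) ≠ 0 := by
  refine hσ.ne_zero h m n (Sum.elim ![k₁, k₂, k₃] Empty.elim) (s * η) ?_
  rw [forall_sum_fin_three, h₁, h₂, h₃]
  simp [point, add_mul, add_assoc]

theorem point_eq_ptE {u' v' : ℂ} (h₁ : -u' = -u + p₁ * η) (h₂ : -v' = -v + p₂ * η)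
    (h₃ : u' + v' = u + v + p₃ * η) : point u' v' = ptE η u v p₁ p₂ p₃ := by
  rw [point, ptE, h₁, h₂, h₃]

end

end QPainleveE6

/-! ### Type E: the four reflections in `ℓ`, and the exponents -/

namespace QPainleveE6

open Complex LatticeQUC

theorem f_g_eq_diag {η : ℂ} (σ : ℤ → ℤ → (Fin 3 ⊕ Empty → ℂ) → ℂ) {A : Fin 7 → ℂ}
    {P Q R : Fin 3 ⊕ Empty → ℂ} (hP : point (logA A) (logB η A) = P)
    (hQ : point (logA A + η / 3) (logB η A - 2 * η / 3) = Q)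
    (hR : point (logA A - η / 3) (logB η A - η / 3) = R) :
    (f η σ A, g η σ A) = (diag σ 0 1 P * (diag σ 1 1 Q * diag σ 2 1 R)
        / (diag σ 0 3 P * (diag σ 1 3 Q * diag σ 2 3 R)),
      diag σ 0 2 P * (diag σ 1 2 Q * diag σ 2 2 R)
        / (diag σ 0 3 P * (diag σ 1 3 Q * diag σ 2 3 R))) := by
  simp only [f, g, U, V, W, hP, hQ, hR, diag, add_zero, mul_assoc]

theorem exp_three_mul_ne {x y x' y' : ℂ} (h : exp (3 * x) ≠ exp (3 * y)) (s : ℂ)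
    (hx : x' = x + s) (hy : y' = y + s) : exp (3 * y') ≠ exp (3 * x') := by
  intro h'
  apply h
  rw [hx, hy, mul_add, mul_add, exp_add, exp_add] at h'
  exact (mul_right_cancel₀ (exp_ne_zero _) h').symm

/-- Start from the tau functions at `(U₀, V₀, W₀)`. The four letters `s_3` change the points
successively to `(U₁, V₀, W₀)`, `(U₁, V₁, W₀)`, `(U₁, V₁, W₁)`, `(U₁, V₂, W₁)`. The last triple is
the first one with `b` replaced by `q⁻¹b`, which is the effect of the parameter shift on `(a, b)`.
-/
theorem solvesAt_f_g {η : ℂ} {d : ℤ → ℤ → ℂ} {σ : ℤ → ℤ → (Fin 3 ⊕ Empty → ℂ) → ℂ}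
    (h : IsReduction η 3 3 d σ) {A : Fin 7 → ℂ} (hA : IsParam η A) (hc : Corresponds η d A)
    (hg : Generic η (logA A) (logB η A))
    (hσ : NonvanishingAlong η σ (point (logA A) (logB η A))) :
    SolvesAt η (f η σ) (g η σ) A := by
  have hd := h.biPeriodic_exponents hσ
  have hA' := hA
  unfold IsParam at hA'
  have hu : logA A = (A 0 + A 1 + A 5) / 3 := rfl
  have hv : logB η A = (A 2 + A 4 + A 6 + η) / 3 := rfl
  have hbu : logA (bar η A) = logA A := rfl
  have hbv : logB η (bar η A) = logB η A - η := by simp [logB, bar]; ring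
  have hf := fun P Q R => f_g_eq_diag (η := η) σ (A := A) (P := P) (Q := Q) (R := R)
  have hf' := fun P Q R => f_g_eq_diag (η := η) σ (A := bar η A) (P := P) (Q := Q) (R := R)
  rw [hbu, hbv] at hf'
  generalize logA A = u at *
  generalize logB η A = v at *
  have per₁ : ∀ {m m' : ℤ} (n : ℤ), m' = m + 3 → d m' n = d m n := by
    rintro m _ n rfl; exact (hd m n).1
  have per₂ : ∀ {n n' : ℤ} (m : ℤ), n' = n + 3 → d m n' = d m n := by
    rintro n _ m rfl; exact (hd m n).2
  -- Periodicity of the exponents matches the indices produced by `act_three_of_diag` with those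
  -- used in `Corresponds`.
  have d31 : d 3 1 = d 3 (-2) := per₂ _ (by norm_num)
  have d40 : d 4 0 = d 4 (-3) := per₂ _ (by norm_num)
  have d4m2 : d 4 (-2) = d 1 1 := (per₁ _ (by norm_num)).trans (per₂ 1 (by norm_num)).symm
  have d5m1 : d 5 (-1) = d 2 (-1) := per₁ _ (by norm_num)
  have d42 : d 4 2 = d 4 (-1) := per₂ _ (by norm_num)
  have d51 : d 5 1 = d 5 (-2) := per₂ _ (by norm_num)
  have d60 : d 6 0 = d 3 0 := per₁ _ (by norm_num)
  have d53 : d 5 3 = d 2 0 := (per₁ _ (by norm_num)).trans (per₂ 2 (by norm_num))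
  have d62 : d 6 2 = d 3 (-1) := (per₁ _ (by norm_num)).trans (per₂ 3 (by norm_num))
  have d71 : d 7 1 = d 1 1 :=
    (per₁ (m := 4) 1 (by norm_num)).trans (per₁ 1 (by norm_num))
  obtain ⟨γ₁, γ₂, γ₃, δ₁, δ₂, δ₃, ε₁, ε₂, ε₃⟩ := hc
  set U₀ := ptE η u v 0 0 0 with hU₀
  set V₀ := ptE η u v (-(1 / 3)) (2 / 3) (-(1 / 3)) with hV₀
  set W₀ := ptE η u v (1 / 3) (1 / 3) (-(2 / 3)) with hW₀
  set U₁ := ptE η u v 0 1 (-1) with hU₁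
  set V₁ := ptE η u v (2 / 3) (2 / 3) (-(4 / 3)) with hV₁
  set W₁ := ptE η u v (1 / 3) (4 / 3) (-(5 / 3)) with hW₁
  set V₂ := ptE η u v (-(1 / 3)) (5 / 3) (-(4 / 3)) with hV₂
  have nU₀ : ∀ c i, diag σ c i U₀ ≠ 0 := fun c i =>
    ptE_ne_zero h hσ 0 0 0 0 (by norm_num) (by norm_num) (by norm_num) _ _
  have nV₀ : ∀ c i, diag σ c i V₀ ≠ 0 := fun c i =>
    ptE_ne_zero h hσ 0 1 0 (-(1 / 3)) (by norm_num) (by norm_num) (by norm_num) _ _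
  have nW₀ : ∀ c i, diag σ c i W₀ ≠ 0 := fun c i =>
    ptE_ne_zero h hσ 0 0 (-1) (1 / 3) (by norm_num) (by norm_num) (by norm_num) _ _
  have nU₁ : ∀ c i, diag σ c i U₁ ≠ 0 := fun c i =>
    ptE_ne_zero h hσ 0 1 (-1) 0 (by norm_num) (by norm_num) (by norm_num) _ _
  have nV₁ : ∀ c i, diag σ c i V₁ ≠ 0 := fun c i =>
    ptE_ne_zero h hσ 0 0 (-2) (2 / 3) (by norm_num) (by norm_num) (by norm_num) _ _
  have nW₁ : ∀ c i, diag σ c i W₁ ≠ 0 := fun c i =>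
    ptE_ne_zero h hσ 0 1 (-2) (1 / 3) (by norm_num) (by norm_num) (by norm_num) _ _
  have nV₂ : ∀ c i, diag σ c i V₂ ≠ 0 := fun c i =>
    ptE_ne_zero h hσ 0 2 (-1) (-(1 / 3)) (by norm_num) (by norm_num) (by norm_num) _ _
  have g12 := fun k => hg 0 1 k (by decide)
  have g13 := fun k => hg 0 2 k (by decide)
  have g23 := fun k => hg 1 2 k (by decide)
  simp only [point, Sum.elim_inl, Matrix.cons_val] at g12 g13 g23
  have c30 : ∀ i, diag σ 3 i = diag σ 0 i := diag_add_three_left h 0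
  have c41 : ∀ i, diag σ 4 i = diag σ 1 i := diag_add_three_left h 1
  refine solvesAt_of_steps hA
    (p₁ := (diag σ 0 1 U₁ * (diag σ 1 1 V₀ * diag σ 2 1 W₀)
        / (diag σ 0 3 U₁ * (diag σ 1 3 V₀ * diag σ 2 3 W₀)),
      diag σ 0 2 U₁ * (diag σ 1 2 V₀ * diag σ 2 2 W₀)
        / (diag σ 0 3 U₁ * (diag σ 1 3 V₀ * diag σ 2 3 W₀))))
    (p₂ := (diag σ 0 1 U₁ * (diag σ 1 1 V₁ * diag σ 2 1 W₀)
        / (diag σ 0 3 U₁ * (diag σ 1 3 V₁ * diag σ 2 3 W₀)),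
      diag σ 0 2 U₁ * (diag σ 1 2 V₁ * diag σ 2 2 W₀)
        / (diag σ 0 3 U₁ * (diag σ 1 3 V₁ * diag σ 2 3 W₀))))
    (p₃ := (diag σ 0 1 U₁ * (diag σ 1 1 V₁ * diag σ 2 1 W₁)
        / (diag σ 0 3 U₁ * (diag σ 1 3 V₁ * diag σ 2 3 W₁)),
      diag σ 0 2 U₁ * (diag σ 1 2 V₁ * diag σ 2 2 W₁)
        / (diag σ 0 3 U₁ * (diag σ 1 3 V₁ * diag σ 2 3 W₁))))
    ?_ ?_ ?_ ?_
  -- At `W₀`, up to scaling, `T_2` leads to the new point of `U`, `T_3` to the old one, and `T_2T_3`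
  -- to that of `V`. The factors `c_x, c_y, c_z` are expressed through the `γ_i`.
  · refine act_three_of_diag h 0 1 2 (θ := W₀) (new := U₁) (old := U₀) (mid := V₀)
      ?_ ?_ ?_ (nU₁ _) (nU₀ _) (nV₀ _) (nW₀ _) ?_ ?_ ?_ ?_ ?_ ?_ ?_
    · intro k
      rw [hW₀, shift_ptE_one]
      refine (ptE_eq_add (1 / 3) ?_ ?_ ?_ k).trans (by rw [hU₁]; ring) <;> norm_num
    · intro k
      rw [hW₀, shift_ptE_two]
      refine (ptE_eq_add (1 / 3) ?_ ?_ ?_ k).trans (by rw [hU₀]; ring) <;> norm_num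
    · intro k
      rw [hW₀, shift_ptE_two, shift_ptE_one]
      refine (ptE_eq_add (2 / 3) ?_ ?_ ?_ k).trans (by rw [hV₀]; ring) <;> norm_num
    · exact exp_three_mul_ne (g23 (-1)) (1 / 3 * η) (by simp [hW₀]) (by simp [hW₀]; ring)
    · simp [hW₀, hu, hv]; linear_combination (1 / 3 : ℂ) * hA'
    · norm_num [d31]; linear_combination γ₂
    · norm_num [d40]; linear_combination γ₃
    · norm_num [d4m2, d5m1]; linear_combination γ₁
    · exact hf _ _ _ (point_eq_ptE (by ring) (by ring) (by ring))
        (point_eq_ptE (by ring) (by ring) (by ring)) (point_eq_ptE (by ring) (by ring) (by ring))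
    · rfl
  -- At `U₁`, `T_1` and `T_3` lead to the new and old points of `V`, and the relevant exponents are
  -- the `δ_i`. The three families are permuted cyclically, so antidiagonal 3 is identified with 0
  -- and the factors are reordered.
  · refine act_three_of_diag h 1 0 2 (θ := U₁) (new := V₁) (old := V₀) (mid := W₀)
      ?_ ?_ ?_ (nV₁ _) (nV₀ _) (nW₀ _) (nU₁ _) ?_ ?_ ?_ ?_ ?_ ?_ ?_
    · intro k
      rw [hU₁, shift_ptE_zero]
      refine (ptE_eq_add (1 / 3) ?_ ?_ ?_ k).trans (by rw [hV₁]; ring) <;> norm_num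
    · intro k
      rw [hU₁, shift_ptE_two]
      refine (ptE_eq_add (1 / 3) ?_ ?_ ?_ k).trans (by rw [hV₀]; ring) <;> norm_num
    · intro k
      rw [hU₁, shift_ptE_two, shift_ptE_zero]
      refine (ptE_eq_add (2 / 3) ?_ ?_ ?_ k).trans (by rw [hW₀]; ring) <;> norm_num
    · exact exp_three_mul_ne (g13 (-1)) 0 (by simp [hU₁]) (by simp [hU₁])
    · simp [hU₁, phi, hu, hv]; linear_combination (2 / 3 : ℂ) * hA'
    · simp [phi, d31, d42]; linear_combination δ₂
    · simp [phi, d40, d51]; linear_combination δ₃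
    · simp [phi, d5m1, d60]; linear_combination δ₁
    · simp only [show (1 : ℤ) + 1 = 2 from rfl, show (1 : ℤ) + 2 = 3 from rfl, c30]
      congr 1 <;> ring
    · simp only [show (1 : ℤ) + 1 = 2 from rfl, show (1 : ℤ) + 2 = 3 from rfl, c30]
      congr 1 <;> ring
  -- At `V₁`, `T_2` and `T_3` lead to the new and old points of `W`, and the relevant exponents are
  -- the `ε_i`.
  · refine act_three_of_diag h 2 1 2 (θ := V₁) (new := W₁) (old := W₀) (mid := U₁)
      ?_ ?_ ?_ (nW₁ _) (nW₀ _) (nU₁ _) (nV₁ _) ?_ ?_ ?_ ?_ ?_ ?_ ?_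
    · intro k
      rw [hV₁, shift_ptE_one]
      refine (ptE_eq_add (1 / 3) ?_ ?_ ?_ k).trans (by rw [hW₁]; ring) <;> norm_num
    · intro k
      rw [hV₁, shift_ptE_two]
      refine (ptE_eq_add (1 / 3) ?_ ?_ ?_ k).trans (by rw [hW₀]; ring) <;> norm_num
    · intro k
      rw [hV₁, shift_ptE_two, shift_ptE_one]
      refine (ptE_eq_add (2 / 3) ?_ ?_ ?_ k).trans (by rw [hU₁]; ring) <;> norm_num
    · exact exp_three_mul_ne (g23 (-2)) (2 / 3 * η) (by simp [hV₁]) (by simp [hV₁]; ring)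
    · simp [hV₁, psi, phi, hu, hv]; linear_combination (4 / 3 : ℂ) * hA'
    · simp [psi, phi, d42, d53]; linear_combination ε₂
    · simp [psi, phi, d51, d62]; linear_combination ε₃
    · simp [psi, phi, d60, d71]; linear_combination ε₁
    · simp only [show (2 : ℤ) + 1 = 3 from rfl, show (2 : ℤ) + 2 = 4 from rfl, c30, c41]
      congr 1 <;> ring
    · simp only [show (2 : ℤ) + 1 = 3 from rfl, show (2 : ℤ) + 2 = 4 from rfl, c30, c41]
      congr 1 <;> ring
  -- Again at `U₁`, but with `T_2` and `T_1`: `V` moves a second time, from `V₁` to `V₂`, with the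
  -- `δ_i` as in the second reflection.
  · refine act_three_of_diag h 1 1 0 (θ := U₁) (new := V₂) (old := V₁) (mid := W₁)
      ?_ ?_ ?_ (nV₂ _) (nV₁ _) (nW₁ _) (nU₁ _) ?_ ?_ ?_ ?_ ?_ ?_ ?_
    · intro k
      rw [hU₁, shift_ptE_one]
      refine (ptE_eq_add (1 / 3) ?_ ?_ ?_ k).trans (by rw [hV₂]; ring) <;> norm_num
    · intro k
      rw [hU₁, shift_ptE_zero]
      refine (ptE_eq_add (1 / 3) ?_ ?_ ?_ k).trans (by rw [hV₁]; ring) <;> norm_num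
    · intro k
      rw [hU₁, shift_ptE_zero, shift_ptE_one]
      refine (ptE_eq_add (2 / 3) ?_ ?_ ?_ k).trans (by rw [hW₁]; ring) <;> norm_num
    · exact exp_three_mul_ne (g12 1).symm 0 (by simp [hU₁]) (by simp [hU₁])
    · simp [hU₁, psi, phi, hu, hv]; linear_combination (2 / 3 : ℂ) * hA'
    · simp [psi, phi, d31, d42]; linear_combination δ₂
    · simp [psi, phi, d40, d51]; linear_combination δ₃
    · simp [psi, phi, d5m1, d60]; linear_combination δ₁
    · simp only [show (1 : ℤ) + 1 = 2 from rfl, show (1 : ℤ) + 2 = 3 from rfl, c30]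
      congr 1 <;> ring
    · rw [hf' U₁ V₂ W₁ (point_eq_ptE (by ring) (by ring) (by ring))
        (point_eq_ptE (by ring) (by ring) (by ring)) (point_eq_ptE (by ring) (by ring) (by ring))]
      simp only [show (1 : ℤ) + 1 = 2 from rfl, show (1 : ℤ) + 2 = 3 from rfl, c30]
      congr 1 <;> ring

/-- For exponents `a(m) + b(n)` of period 3 there are four free differences, `x = a(1) - a(2)`, `y =
a(2) - a(0)`, `w = b(0) - b(1)`, `z = b(1) - b(2)`. The conditions for `γ_1, γ_2, δ_1, δ_2` read `x
+ z = G₁`, `y + w = G₂`, `y - w - z = D₁`, `z - x - y = D₂` and determine them. The other five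
follow, since on both sides the `γ_i` and the `δ_i` sum to zero, in logarithms, and `γ_i + δ_i + ε_i
= 0`. -/
theorem exists_exponents {η : ℂ} (hη : η ≠ 0) (A : Fin 7 → ℂ) :
    ∃ d : ℤ → ℤ → ℂ, Balanced d ∧ BiPeriodic 3 3 d ∧ Corresponds η d A := by
  set G₁ := (A 0 + 2 * A 6 - A 1 - 2 * A 2) / η with hG₁
  set G₂ := (A 1 + 2 * A 2 - 2 * A 4 - A 5) / η with hG₂
  set D₁ := (A 0 + A 2 - A 1 - A 6) / η with hD₁
  set D₂ := (A 1 + A 4 - A 2 - A 5) / η with hD₂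
  set z := (2 * D₂ + 2 * G₁ + G₂ + D₁) / 3 with hz
  set w := (G₂ - D₁ - z) / 2 with hw
  set x := G₁ - z with hx
  set y := G₂ - w with hy
  set a : ℤ → ℂ := fun m => if m % 3 = 0 then 0 else if m % 3 = 1 then x + y else y with ha
  set b : ℤ → ℂ := fun n => if n % 3 = 0 then 0 else if n % 3 = 1 then -w else -w - z with hb
  refine ⟨fun m n => a m + b n, fun m n => by ring, fun m n => ?_, ?_⟩
  · simp [ha, hb]
  · constructor <;> norm_num [ha, hb] <;> simp only [hx, hy, hw, hz, hG₁, hG₂, hD₁, hD₂] <;>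
      field_simp <;> ring

end QPainleveE6

/-- Reduction of the lattice q-UC hierarchy (`q = exp η`) to the q-Painlevé equations of types
`A_{2g+1}^{(1)}`, `D_5^{(1)}` and `E_6^{(1)}`.  In each case the first clause is the reduction and
the last one says that all parameters of the q-Painlevé equation are obtained. -/
theorem theorem1p1 (η : ℂ) (hη : η ≠ 0) :
    -- type `A_{2g+1}^{(1)}`, periodicity of order `(g+1, g+1)`
    (∀ g : ℕ, 1 ≤ g →
      (∀ (d : ℤ → ℤ → ℂ) (σ : ℤ → ℤ → (Fin 2 ⊕ Fin 2 → ℂ) → ℂ),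
        LatticeQUC.IsReduction η (g + 1) (g + 1) d σ →
        ∀ a ξ : ℂ, QPainleveA.Generic g η a ξ →
          LatticeQUC.NonvanishingAlong η σ (QPainleveA.point η a ξ 0 0) →
          QPainleveA.IsParam g (Complex.exp ((g + 1) * η / 2)) (QPainleveA.param η ξ d) ∧
          QPainleveA.IsSolution g (QPainleveA.param η ξ d) (QPainleveA.f η a ξ σ)) ∧
      (∀ p : ℤ → ℂ, QPainleveA.IsParam g (Complex.exp ((g + 1) * η / 2)) p →
        ∃ (d : ℤ → ℤ → ℂ) (ξ : ℂ), LatticeQUC.Balanced d ∧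
          LatticeQUC.BiPeriodic (g + 1) (g + 1) d ∧ p = QPainleveA.param η ξ d)) ∧
    -- type `D_5^{(1)}`, periodicity of order `(2, 2)`
    ((∀ (d : ℤ → ℤ → ℂ) (σ : ℤ → ℤ → (Fin 2 ⊕ Fin 2 → ℂ) → ℂ),
        LatticeQUC.IsReduction η 2 2 d σ →
        ∀ a b ξ : ℂ, QPainleveD5.Generic η a b ξ →
          LatticeQUC.NonvanishingAlong η σ (QPainleveD5.point η a b ξ) →
          QPainleveD5.SymmetricEquation (Complex.exp η) (Complex.exp a) (Complex.exp b)
            (QPainleveD5.gam η d) (QPainleveD5.del η d) (Complex.exp ξ)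
            (QPainleveD5.f η σ a b ξ) (QPainleveD5.f η σ a b (ξ + η))
            (QPainleveD5.g η σ a b ξ) (QPainleveD5.g η σ a b (ξ - η)) ∧
          QPainleveD5.IsParam (Complex.exp η ^ 2)
            (QPainleveD5.paramA (Complex.exp a) (Complex.exp b)
              (QPainleveD5.gam η d) (QPainleveD5.del η d))
            (QPainleveD5.paramB (Complex.exp η) (Complex.exp a) (Complex.exp b)
              (QPainleveD5.gam η d) (QPainleveD5.del η d)) ∧
          QPainleveD5.Equation
            (QPainleveD5.paramA (Complex.exp a) (Complex.exp b)
              (QPainleveD5.gam η d) (QPainleveD5.del η d))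
            (QPainleveD5.paramB (Complex.exp η) (Complex.exp a) (Complex.exp b)
              (QPainleveD5.gam η d) (QPainleveD5.del η d))
            (Complex.exp ξ ^ 2)
            (Complex.exp ξ * QPainleveD5.f η σ a b ξ)
            (Complex.exp (ξ + η) * QPainleveD5.f η σ a b (ξ + η))
            (Complex.exp (ξ - η) * QPainleveD5.g η σ a b (ξ - η))
            (Complex.exp ξ * QPainleveD5.g η σ a b ξ)) ∧
      (∀ a' b' : Fin 4 → ℂ, QPainleveD5.IsParam (Complex.exp η ^ 2) a' b' →
        ∃ (d : ℤ → ℤ → ℂ) (a b l m k : ℂ), LatticeQUC.Balanced d ∧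
          LatticeQUC.BiPeriodic 2 2 d ∧ l ≠ 0 ∧ m ≠ 0 ∧ k ≠ 0 ∧
          a' = QPainleveD5.rescale l k
            (QPainleveD5.paramA (Complex.exp a) (Complex.exp b)
              (QPainleveD5.gam η d) (QPainleveD5.del η d)) ∧
          b' = QPainleveD5.rescale m k
            (QPainleveD5.paramB (Complex.exp η) (Complex.exp a) (Complex.exp b)
              (QPainleveD5.gam η d) (QPainleveD5.del η d)))) ∧
    -- type `E_6^{(1)}`, periodicity of order `(3, 3)`
    ((∀ (d : ℤ → ℤ → ℂ) (σ : ℤ → ℤ → (Fin 3 ⊕ Empty → ℂ) → ℂ),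
        LatticeQUC.IsReduction η 3 3 d σ →
        ∀ A : Fin 7 → ℂ, QPainleveE6.IsParam η A → QPainleveE6.Corresponds η d A →
          QPainleveE6.Generic η (QPainleveE6.logA A) (QPainleveE6.logB η A) →
          LatticeQUC.NonvanishingAlong η σ
            (QPainleveE6.point (QPainleveE6.logA A) (QPainleveE6.logB η A)) →
          QPainleveE6.SolvesAt η (QPainleveE6.f η σ) (QPainleveE6.g η σ) A) ∧
      (∀ A : Fin 7 → ℂ, QPainleveE6.IsParam η A →
        ∃ d : ℤ → ℤ → ℂ, LatticeQUC.Balanced d ∧ LatticeQUC.BiPeriodic 3 3 d ∧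
          QPainleveE6.Corresponds η d A)) := by
  refine ⟨fun g _ => ⟨fun d σ h a ξ hg hσ => ?_, fun p hp => QPainleveA.exists_exponents hη hp⟩,
    ⟨fun d σ h a b ξ hg hσ => ?_, fun a' b' h => QPainleveD5.exists_exponents hη h⟩,
    fun d σ h A hA hc hg hσ => QPainleveE6.solvesAt_f_g h hA hc hg hσ,
    fun A _ => QPainleveE6.exists_exponents hη A⟩
  · exact ⟨QPainleveA.isParam_param ξ (h.biPeriodic_exponents hσ),
      QPainleveA.isSolution_f h hg hσ⟩
  · have hs := QPainleveD5.symmetricEquation h hg hσ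
    have hγ : QPainleveD5.gam η d ≠ 0 := Complex.exp_ne_zero _
    have hδ : QPainleveD5.del η d ≠ 0 := Complex.exp_ne_zero _
    have he := hs.equation (Complex.exp_ne_zero η) (Complex.exp_ne_zero a)
      (Complex.exp_ne_zero b) hγ hδ (Complex.exp_ne_zero ξ)
    refine ⟨hs, QPainleveD5.paramA_paramB_isParam (Complex.exp_ne_zero η) (Complex.exp_ne_zero a)
      (Complex.exp_ne_zero b) hγ hδ, ?_⟩
    rw [Complex.exp_add, Complex.exp_sub]
    exact he
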